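/- **Setting.** Let $G=(V,E)$ be a finite connected planar geometric graph: the nodes are distinct points of the Euclidean plane, the edges are straight segments, and two different edges meet at most in a common end node. A *face* is a maximal region of the plane any two points of which can be joined by a curve avoiding all edges; a node or edge *borders* a face if it lies in its closure. Let $s\neq d$ be nodes and let $(s,d)$ be the open segment between them. A face *intersects* $(s,d)$ if its closure does; an edge intersects $(s,d)$ if it has a point in common with it. For every edge that intersects $(s,d)$ at least one of its end nodes (possibly both) is designated. A node $n$ is an *entry point* to the two different faces $F$ and $F'$ if an edge at $n$ for which $n$ is designated intersects $(s,d)$ and borders both $F$ and $F'$ (both then intersect $(s,d)$). Two faces that share an entry point are adjacent. **Algorithm 2FACE.** Each node has a send queue $SQ$ of tokens $T(s,d,F)$, $T\in\{R,L\}$, $F$ a face, each with the neighbor to which it is to be sent. Initially all queues are empty, except that $s$ holds a pair $L(s,d,F)$, $R(s,d,F)$ for a face $F$ that borders $s$ and intersects $(s,d)$. In general, to start a traversal of $F$ at a node $n$ means to choose neighbors $b,c$ of $n$ such that $(n,c)$ is the next edge after $(n,b)$ clockwise and the angle between them belongs to $F$, and to queue $R(s,d,F)$ for $c$ and $L(s,d,F)$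 for $b$. When a node $n$ receives $T(s,d,F)$ from its neighbor $b$: 1. if $SQ$ of $n$ contains the matching token, that is, the token of the opposite type for $F$, queued to be sent to $b$ (the two tokens meet head-on), both tokens are deleted; 2. otherwise, if $n=d$, the token is delivered; if $n\ne d$ and $n$ is an entry point to $F$, then $n$ starts a traversal of every other face $F'$ to which it is an entry point; in both cases, and if $n$ is neither, $n$ then queues $T(s,d,F)$ for the next neighbor along $F$, which is the one whose edge comes next after $(n,b)$ clockwise if $T=R$, and counter-clockwise if $T=L$. **Execution model.** A computation is a sequence of atomic actions. In an action one node transmits one token of its queue, in no prescribed order; the token is removed there and is instantaneously received and handled at the receiver. Transmission is reliable and the system is asynchronous: every queued token is transmitted or deleted after an arbitrary but finite time. **Theorem.** Algorithm 2FACE guarantees the delivery of the message from $s$ to $d$: in every computation, for every choice of designated end nodes, a token is eventually delivered at $d$. -/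

import Mathlib

noncomputable section

namespace TwoFace

/-- A geometric graph: the nodes are distinct points of the Euclidean plane `ℂ`, the edges are
drawn as straight segments. -/
structure GeometricGraph (V : Type*) where
  graph : SimpleGraph V
  pos : V → ℂ
  pos_injective : Function.Injective pos

/-- The two traversal rules; a token is of type `R` (right-hand rule) or `L` (left-hand rule). -/
inductive Hand
  | R
  | L

/-- The opposite traversal rule. -/
def Hand.opp : Hand → Hand
  | Hand.R => Hand.L
  | Hand.L => Hand.R

/-- The angle in `(0, 2π]` of the clockwise rotation that takes the direction of `u` to the
direction of `v`. -/
def cwAngle (u v : ℂ) : ℝ :=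
  toIocMod Real.two_pi_pos 0 (u.arg - v.arg)

/-- The angle in `(0, 2π]` swept from the direction of `u` to the direction of `v`: clockwise for
the right-hand rule, counter-clockwise for the left-hand rule. -/
def Hand.sweep : Hand → ℂ → ℂ → ℝ
  | Hand.R, u, v => cwAngle u v
  | Hand.L, u, v => cwAngle v u

/-- A token `T(s,d,F)`, with `s` and `d` fixed: the traversal rule `T` and the face `F`. -/
structure Token where
  hand : Hand
  face : Set ℂ

/-- An item of a send queue: a token with the neighbor to which it is to be sent. -/
structure Packet (V : Type*) where
  token : Token
  dest : V

/-- A global state: the send queue `SQ` of every node, and the tokens delivered so far at `d`. -/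
structure Config (V : Type*) where
  sq : V → Multiset (Packet V)
  delivered : Multiset Token

namespace GeometricGraph

variable {V : Type*} (G : GeometricGraph V)

/-- The drawing of the edge between `a` and `b`, end points included. -/
def edgeSeg (a b : V) : Set ℂ := segment ℝ (G.pos a) (G.pos b)

/-- Two different edges meet at most in common end nodes. -/
def Planar : Prop :=
  ∀ a b c e : V, G.graph.Adj a b → G.graph.Adj c e → s(a, b) ≠ s(c, e) →
    G.edgeSeg a b ∩ G.edgeSeg c e ⊆ G.pos '' (({a, b} : Set V) ∩ {c, e})

/-- The union of all edges, as a subset of the plane. -/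
def drawing : Set ℂ := {z | ∃ a b : V, G.graph.Adj a b ∧ z ∈ G.edgeSeg a b}

/-- A face: a maximal region any two points of which are joined by a curve that avoids all
edges. -/
def IsFace (F : Set ℂ) : Prop :=
  ∃ z ∈ G.drawingᶜ, F = pathComponentIn G.drawingᶜ z

/-- The node `n` borders the face `F`. -/
def NodeBorders (n : V) (F : Set ℂ) : Prop := G.pos n ∈ closure F

/-- The edge between `a` and `b` borders the face `F`. -/
def EdgeBorders (a b : V) (F : Set ℂ) : Prop := G.edgeSeg a b ⊆ closure F

/-- The segment `(s,d)` between source and destination, without its two end points. -/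
def sdSeg (s d : V) : Set ℂ := openSegment ℝ (G.pos s) (G.pos d)

/-- The face `F`, taken with its boundary, intersects `(s,d)`. -/
def FaceMeets (s d : V) (F : Set ℂ) : Prop := (closure F ∩ G.sdSeg s d).Nonempty

/-- `a` and `b` are joined by an edge that intersects `(s,d)`. -/
def CrossingEdge (s d a b : V) : Prop :=
  G.graph.Adj a b ∧ (G.edgeSeg a b ∩ G.sdSeg s d).Nonempty

/-- `c` is the neighbor of `a` whose edge comes next after the edge `(a,b)`, clockwise for the
right-hand rule and counter-clockwise for the left-hand rule. It is `b` itself only if `a` has no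
other neighbor. -/
def IsNext (h : Hand) (a b c : V) : Prop :=
  G.graph.Adj a c ∧ ∀ c', G.graph.Adj a c' →
    h.sweep (G.pos b - G.pos a) (G.pos c - G.pos a) ≤
      h.sweep (G.pos b - G.pos a) (G.pos c' - G.pos a)

/-- The region `F` lies immediately to the left of the edge from `a` to `b`. -/
def LeftOf (a b : V) (F : Set ℂ) : Prop :=
  ∀ᶠ ε : ℝ in nhdsWithin 0 (Set.Ioi 0),
    midpoint ℝ (G.pos a) (G.pos b) + (ε : ℂ) * (Complex.I * (G.pos b - G.pos a)) ∈ F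

/-- The angle at `n` from the edge `(n,b)` clockwise to the next edge `(n,c)` belongs to the
face `F`. A traversal of `F` that starts in this angle sends `R` to `c` and `L` to `b`. -/
def IsCorner (n b c : V) (F : Set ℂ) : Prop :=
  G.graph.Adj n b ∧ G.IsNext Hand.R n b c ∧ G.LeftOf n c F

/-- `n` is an entry point to `F` (and to another face `F'`): some edge at `n` intersects `(s,d)`
and borders the two different faces `F` and `F'`, both of which intersect `(s,d)`. For an edge that
intersects `(s,d)`, `resp n m` says that its end node `n` plays the role of entry point; this
may be one of the end nodes or both. -/
def IsEntryPoint (s d : V) (resp : V → V → Prop) (n : V) (F : Set ℂ) : Prop :=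
  G.IsFace F ∧ G.NodeBorders n F ∧ G.FaceMeets s d F ∧
    ∃ F' : Set ℂ, F' ≠ F ∧ G.IsFace F' ∧ G.NodeBorders n F' ∧ G.FaceMeets s d F' ∧
      ∃ m : V, G.CrossingEdge s d n m ∧ resp n m ∧
        G.EdgeBorders n m F ∧ G.EdgeBorders n m F'

/-- The pair of tokens that starts a traversal of `F` from an angle given by the pair `p` of
neighbors. -/
def tokenPair (F : Set ℂ) (p : V × V) : Multiset (Packet V) :=
  {⟨⟨Hand.L, F⟩, p.1⟩, ⟨⟨Hand.R, F⟩, p.2⟩}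

open Classical in
/-- Node `n` receives the token `T` from its neighbor `b`. `Receive s d resp n b T q q' del` says
that this may turn the send queue `q` of `n` into `q'`, and `del` collects the tokens
delivered in this step. -/
inductive Receive (s d : V) (resp : V → V → Prop) (n b : V) (T : Token)
    (q : Multiset (Packet V)) : Multiset (Packet V) → Multiset Token → Prop
  /-- The token of the opposite traversal rule for the same face is about to be sent to `b`:
  the two tokens meet, and both are deleted. -/
  | meet (hmeet : (⟨⟨T.hand.opp, T.face⟩, b⟩ : Packet V) ∈ q) :
      Receive s d resp n b T q (q.erase ⟨⟨T.hand.opp, T.face⟩, b⟩) 0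
  /-- At the destination the token is delivered, and retransmitted. -/
  | deliver (hmeet : (⟨⟨T.hand.opp, T.face⟩, b⟩ : Packet V) ∉ q) (hd : n = d)
      (x : V) (hx : G.IsNext T.hand n b x) :
      Receive s d resp n b T q (⟨T, x⟩ ::ₘ q) {T}
  /-- At any other node the token is retransmitted; if `n` is an entry point to the face of
  the token, a traversal is started of each of the other faces (the finite set `S`) to which `n`
  is an entry point. If `n` has several angles in such a face, any of them may be used. -/
  | forward (hmeet : (⟨⟨T.hand.opp, T.face⟩, b⟩ : Packet V) ∉ q) (hd : n ≠ d)
      (x : V) (hx : G.IsNext T.hand n b x)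
      (S : Finset (Set ℂ))
      (hS : ∀ F', F' ∈ S ↔ F' ≠ T.face ∧ G.IsEntryPoint s d resp n T.face ∧
        G.IsEntryPoint s d resp n F')
      (κ : Set ℂ → V × V) (hκ : ∀ F' ∈ S, G.IsCorner n (κ F').1 (κ F').2 F') :
      Receive s d resp n b T q (⟨T, x⟩ ::ₘ (q + ∑ F' ∈ S, tokenPair F' (κ F'))) 0

open Classical in
/-- An atomic action: some node `m` transmits some packet `p` of its send queue, which is removed
there and instantaneously received and handled at the neighbor `p.dest`. -/
def Step (s d : V) (resp : V → V → Prop) (c c' : Config V) : Prop :=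
  ∃ (m : V) (p : Packet V), p ∈ c.sq m ∧
    ∃ (q' : Multiset (Packet V)) (del : Multiset Token),
      let sq₁ := Function.update c.sq m ((c.sq m).erase p)
      G.Receive s d resp p.dest m p.token (sq₁ p.dest) q' del ∧
        c' = ⟨Function.update sq₁ p.dest q', c.delivered + del⟩

open Classical in
/-- Initially the source holds the two tokens `L` and `R` for a face that borders `s` and
intersects `(s,d)`, and nothing else has happened. -/
def Initial (s d : V) (c : Config V) : Prop :=
  ∃ (F : Set ℂ) (p : V × V), G.IsFace F ∧ G.NodeBorders s F ∧ G.FaceMeets s d F ∧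
    G.IsCorner s p.1 p.2 F ∧
      c = ⟨Function.update (fun _ => 0) s (tokenPair F p), 0⟩

open Classical in
/-- A computation: it starts in an initial state, each move is an atomic action or leaves the
state unchanged, and a packet in a send queue is, after an arbitrary but finite time,
transmitted or deleted. -/
def IsComputation (s d : V) (resp : V → V → Prop) (c : ℕ → Config V) : Prop :=
  G.Initial s d (c 0) ∧
    (∀ t, G.Step s d resp (c t) (c (t + 1)) ∨ c (t + 1) = c t) ∧
    ∀ (t : ℕ) (n : V) (p : Packet V), p ∈ (c t).sq n →
      ∃ t' ≥ t, ((c (t' + 1)).sq n).count p < ((c t').sq n).count p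

end GeometricGraph

end TwoFace

end

/-! ### Clockwise angles modulo `2π`. -/

noncomputable section

namespace TwoFace

/-! Suppose that nothing is ever delivered, and call a face seen if a packet for it is queued at
some time. The contradiction is that the closures of the seen faces cover `(s,d)`, hence contain
`d`, although `d` never holds a packet.

A traversal covers the whole boundary of its face. Call a corner visited once a token has appeared
in it. If a corner is visited and its successor along the face is not, then an `R` token waits on
the dart between them (`hasR_of_visited`). By fairness this token moves on or meets an `L` token
waiting in the successor corner; either way the successor becomes visited. Because the graph is
connected, the darts with a given face on their left form a single orbit of `faceNext`
(`Planar.sameWalk_of_leftFace_eq`), so every boundary node receives a packet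
(`seenAt_of_leftFace_eq`).

The single orbit is proved by induction on the graph, deleting a leaf edge or an edge that is not a
bridge. The topological input is that an edge on a cycle has different faces on its two sides
(`Planar.leftFace_ne`); this is a winding number argument.

Since the queue of `d` stays empty, `d` is not in the closure of a seen face
(`dest_notMem_closure`). The union of these closures is closed, there being finitely many faces, and
it is a neighborhood of each of its points on `(s,d)` (`seen_mem_nhds`): at a crossing edge a
designated end node hands the traversal to the other side (`seen_across`). The connectedness of
`(s,d)` finishes the proof.

The handover can fail at `s`, which queues its initial pair without having received a token. An edge
at `s` that meets `(s,d)` runs along it; if it does not contain `d`, its other end is on `(s,d)`,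
and counting around that node replaces the handover (`seen_leftFace_of_node`). -/

theorem cwAngle_pos (u v : ℂ) : 0 < cwAngle u v := left_lt_toIocMod _ _ _

theorem cwAngle_le (u v : ℂ) : cwAngle u v ≤ 2 * Real.pi := by
  simpa [cwAngle] using toIocMod_le_right Real.two_pi_pos 0 (u.arg - v.arg)

theorem exists_cwAngle_add (u v : ℂ) :
    ∃ k : ℤ, u.arg - v.arg = cwAngle u v + k * (2 * Real.pi) :=
  ⟨toIocDiv Real.two_pi_pos 0 (u.arg - v.arg), by
    rw [cwAngle, toIocMod_add_toIocDiv_mul]⟩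

theorem cwAngle_eq_of_arg {u v : ℂ} {α : ℝ} (h0 : 0 < α) (h1 : α ≤ 2 * Real.pi)
    (k : ℤ) (h : u.arg - v.arg = α + k * (2 * Real.pi)) : cwAngle u v = α := by
  rw [cwAngle, toIocMod_eq_iff]
  exact ⟨⟨h0, by simpa using h1⟩, k, by simpa using h⟩

/-- With the range `(0, 2π]` a direction comes last in its own rotation, so that the successor of an
edge is the edge itself only at a node of degree one. -/
theorem cwAngle_self (u : ℂ) : cwAngle u u = 2 * Real.pi :=
  cwAngle_eq_of_arg Real.two_pi_pos le_rfl (-1) (by simp)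

/-- The two sides agree modulo `2π`, and the hypothesis puts the right one into `(0, 2π]`, where
representatives are unique. -/
theorem cwAngle_sub_left {u v w : ℂ} (h : cwAngle u v < cwAngle u w) :
    cwAngle v w = cwAngle u w - cwAngle u v := by
  obtain ⟨k, hk⟩ := exists_cwAngle_add u v
  obtain ⟨l, hl⟩ := exists_cwAngle_add u w
  refine cwAngle_eq_of_arg (by linarith) (by linarith [cwAngle_pos u v, cwAngle_le u w]) (l - k) ?_
  push_cast
  linarith

theorem cwAngle_sub_right {u v w : ℂ} (h : cwAngle v w < cwAngle u w) :
    cwAngle u v = cwAngle u w - cwAngle v w := by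
  obtain ⟨k, hk⟩ := exists_cwAngle_add v w
  obtain ⟨l, hl⟩ := exists_cwAngle_add u w
  refine cwAngle_eq_of_arg (by linarith) (by linarith [cwAngle_pos v w, cwAngle_le u w]) (l - k) ?_
  push_cast
  linarith

/-- Equality of the directions of two vectors. -/
theorem exists_pos_mul_of_cwAngle_eq {u v w : ℂ} (hv : v ≠ 0)
    (h : cwAngle u v = cwAngle u w) : ∃ r : ℝ, 0 ≤ r ∧ w = r * v := by
  obtain ⟨k, hk⟩ := exists_cwAngle_add u v
  obtain ⟨l, hl⟩ := exists_cwAngle_add u w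
  have hvw : v.arg = w.arg := by
    have h1 : v.arg - w.arg = (l - k : ℤ) * (2 * Real.pi) := by push_cast; linarith
    have h2 : (l - k : ℤ) = 0 := by
      by_contra hne
      have h3 : (1 : ℝ) ≤ |((l - k : ℤ) : ℝ)| := by
        exact_mod_cast Int.one_le_abs hne
      have h4 : |v.arg - w.arg| < 2 * Real.pi := by
        rw [abs_lt]
        constructor <;> linarith [v.neg_pi_lt_arg, v.arg_le_pi, w.neg_pi_lt_arg, w.arg_le_pi]
      rw [h1, abs_mul, abs_of_pos Real.two_pi_pos] at h4
      nlinarith [Real.two_pi_pos]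
    rw [h2] at h1
    simpa [sub_eq_zero] using h1
  refine ⟨‖w‖ / ‖v‖, by positivity, ?_⟩
  have hv' : (‖v‖ : ℂ) ≠ 0 := by simpa using hv
  conv_lhs => rw [← Complex.norm_mul_exp_arg_mul_I w]
  conv_rhs => rw [← Complex.norm_mul_exp_arg_mul_I v]
  rw [hvw]
  push_cast
  simp only [norm_mul, Complex.norm_real, norm_norm, Complex.norm_exp_ofReal_mul_I, mul_one]
  field_simp

theorem arg_mul_exp_neg {u : ℂ} (hu : u ≠ 0) {r : ℝ} (hr : 0 < r) (θ : ℝ) :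
    ∃ k : ℤ, u.arg - (r * u * Complex.exp (-(θ * Complex.I))).arg = θ + k * (2 * Real.pi) := by
  have h : ((r * u * Complex.exp (-(θ * Complex.I))).arg : Real.Angle) = (u.arg - θ : ℝ) := by
    have hr' : (r : ℂ) ≠ 0 := by exact_mod_cast hr.ne'
    rw [Complex.arg_mul_coe_angle (by positivity) (Complex.exp_ne_zero _),
      Complex.arg_real_mul _ hr]
    have : Complex.exp (-(θ * Complex.I)) = Complex.exp (((-θ : ℝ) : ℂ) * Complex.I) := by
      push_cast; ring_nf
    rw [this, Complex.arg_exp_mul_I, sub_eq_add_neg, Real.Angle.coe_add]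
    congr 1
    rw [Real.Angle.angle_eq_iff_two_pi_dvd_sub]
    exact ⟨-toIocDiv Real.two_pi_pos (-Real.pi) (-θ), by
      rw [toIocMod_sub_self_eq_mul]; push_cast; ring⟩
  rw [Real.Angle.angle_eq_iff_two_pi_dvd_sub] at h
  obtain ⟨k, hk⟩ := h
  exact ⟨-k, by push_cast; linarith⟩

theorem cwAngle_mul_exp_neg {u : ℂ} (hu : u ≠ 0) {r θ : ℝ} (hr : 0 < r) (h0 : 0 < θ)
    (h1 : θ ≤ 2 * Real.pi) : cwAngle u (r * u * Complex.exp (-(θ * Complex.I))) = θ := by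
  obtain ⟨k, hk⟩ := arg_mul_exp_neg hu hr θ
  exact cwAngle_eq_of_arg h0 h1 k hk

theorem exists_eq_mul_exp_cwAngle {u v : ℂ} (hu : u ≠ 0) (hv : v ≠ 0) :
    ∃ r : ℝ, 0 < r ∧ v = r * u * Complex.exp (-(cwAngle u v * Complex.I)) := by
  have h := cwAngle_mul_exp_neg hu one_pos (cwAngle_pos u v) (cwAngle_le u v)
  have hne : (1 : ℝ) * u * Complex.exp (-(cwAngle u v * Complex.I)) ≠ 0 := by
    simp [hu]
  obtain ⟨r, hr, hrv⟩ := exists_pos_mul_of_cwAngle_eq hne h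
  refine ⟨r, lt_of_le_of_ne hr ?_, hrv.trans (by push_cast; ring)⟩
  rintro rfl
  simp at hrv
  exact hv hrv

/-! ### The cyclic order of the edges at a node. -/

namespace GeometricGraph

variable {V : Type*} {G : GeometricGraph V}

theorem pos_sub_ne_zero {a b : V} (h : a ≠ b) : G.pos a - G.pos b ≠ 0 :=
  sub_ne_zero.2 (G.pos_injective.ne h)

theorem pos_sub_ne_zero_of_adj {a b : V} (h : G.graph.Adj a b) : G.pos b - G.pos a ≠ 0 :=
  pos_sub_ne_zero h.ne'

theorem edgeSeg_comm (a b : V) : G.edgeSeg a b = G.edgeSeg b a := segment_symm _ _ _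

theorem mem_edgeSeg_iff {a b : V} {z : ℂ} :
    z ∈ G.edgeSeg a b ↔ ∃ t : ℝ, 0 ≤ t ∧ t ≤ 1 ∧ z = G.pos a + t * (G.pos b - G.pos a) := by
  rw [edgeSeg, segment_eq_image']
  constructor
  · rintro ⟨t, ht, rfl⟩
    exact ⟨t, ht.1, ht.2, by simp⟩
  · rintro ⟨t, h0, h1, rfl⟩
    exact ⟨t, ⟨h0, h1⟩, by simp⟩

/-- Different edges at a node have different directions. -/
theorem Planar.eq_of_direction (hG : G.Planar) {n b c : V} (hb : G.graph.Adj n b)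
    (hc : G.graph.Adj n c) {r : ℝ} (hr : 0 ≤ r)
    (h : G.pos c - G.pos n = r * (G.pos b - G.pos n)) : b = c := by
  by_contra hbc
  have key : ∀ {b c : V} {r : ℝ}, G.graph.Adj n b → G.graph.Adj n c → b ≠ c → 0 ≤ r → r ≤ 1 →
      G.pos c - G.pos n = r * (G.pos b - G.pos n) → False := by
    intro b c r hb hc hbc hr hr1 h
    have hne : s(n, b) ≠ s(n, c) := mt Sym2.congr_right.1 hbc
    have h1 : G.pos c ∈ G.edgeSeg n b := mem_edgeSeg_iff.2 ⟨r, hr, hr1, by linear_combination h⟩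
    have h2 : G.pos c ∈ G.edgeSeg n c := right_mem_segment _ _ _
    obtain ⟨x, ⟨hx1, hx2⟩, hx⟩ := hG n b n c hb hc hne ⟨h1, h2⟩
    obtain rfl := G.pos_injective hx
    rcases hx1 with rfl | rfl
    · exact hc.ne rfl
    · exact hbc rfl
  rcases le_total r 1 with h1 | h1
  · exact key hb hc hbc hr h1 h
  · have hr0 : r ≠ 0 := by linarith
    refine key (r := r⁻¹) hc hb (Ne.symm hbc) (by positivity) (inv_le_one_of_one_le₀ h1) ?_
    rw [h, Complex.ofReal_inv, inv_mul_cancel_left₀ (by exact_mod_cast hr0)]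

theorem Planar.eq_of_cwAngle_eq (hG : G.Planar) {n b c : V} {u : ℂ} (hb : G.graph.Adj n b)
    (hc : G.graph.Adj n c)
    (h : cwAngle u (G.pos b - G.pos n) = cwAngle u (G.pos c - G.pos n)) : b = c := by
  obtain ⟨r, hr, h⟩ := exists_pos_mul_of_cwAngle_eq (pos_sub_ne_zero_of_adj hb) h
  exact hG.eq_of_direction hb hc hr h

theorem IsNext.unique (hG : G.Planar) {n b c c' : V} (h : G.IsNext Hand.R n b c)
    (h' : G.IsNext Hand.R n b c') : c = c' :=
  hG.eq_of_cwAngle_eq h.1 h'.1 (le_antisymm (h.2 _ h'.1) (h'.2 _ h.1))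

theorem exists_minimal_cwAngle [Finite V] {n b : V} (u : ℂ) (hb : G.graph.Adj n b) :
    ∃ c, G.graph.Adj n c ∧ ∀ c', G.graph.Adj n c' →
      cwAngle u (G.pos c - G.pos n) ≤ cwAngle u (G.pos c' - G.pos n) := by
  obtain ⟨c, hc, hmin⟩ := Set.exists_min_image {c | G.graph.Adj n c}
    (fun c => cwAngle u (G.pos c - G.pos n)) (Set.toFinite _) ⟨b, hb⟩
  exact ⟨c, hc, hmin⟩

theorem exists_isNext [Finite V] {n b : V} (hb : G.graph.Adj n b) :
    ∃ c, G.IsNext Hand.R n b c :=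
  exists_minimal_cwAngle _ hb

/-- A neighbor strictly inside the counter-clockwise sweep from `c` to `b` would be strictly inside
the clockwise sweep from `b` to `c`. Thus the two traversal rules follow the same walk in opposite
directions. -/
theorem IsNext.toLeft {n b c : V} (hb : G.graph.Adj n b) (h : G.IsNext Hand.R n b c) :
    G.IsNext Hand.L n c b := by
  refine ⟨hb, fun c' hc' => ?_⟩
  by_contra! hlt
  have h1 := h.2 c' hc'
  simp only [Hand.sweep] at hlt h1
  have h2 := cwAngle_sub_right hlt
  linarith [cwAngle_pos (G.pos c' - G.pos n) (G.pos c - G.pos n)]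

theorem IsNext.toRight {n b c : V} (hb : G.graph.Adj n b) (h : G.IsNext Hand.L n b c) :
    G.IsNext Hand.R n c b := by
  refine ⟨hb, fun c' hc' => ?_⟩
  by_contra! hlt
  have h1 := h.2 c' hc'
  simp only [Hand.sweep] at hlt h1
  have h2 := cwAngle_sub_left hlt
  linarith [cwAngle_pos (G.pos c - G.pos n) (G.pos c' - G.pos n)]

theorem IsNext.injective (hG : G.Planar) {n b b' c : V} (hb : G.graph.Adj n b)
    (hb' : G.graph.Adj n b') (h : G.IsNext Hand.R n b c) (h' : G.IsNext Hand.R n b' c) :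
    b = b' := by
  have h1 := (h.toLeft hb).2 b' hb'
  have h2 := (h'.toLeft hb').2 b hb
  simp only [Hand.sweep] at h1 h2
  have h3 := le_antisymm h1 h2
  obtain ⟨k, hk⟩ := exists_cwAngle_add (G.pos b - G.pos n) (G.pos c - G.pos n)
  obtain ⟨l, hl⟩ := exists_cwAngle_add (G.pos b' - G.pos n) (G.pos c - G.pos n)
  have h4 : cwAngle (G.pos b - G.pos n) (G.pos b' - G.pos n) =
      cwAngle (G.pos b - G.pos n) (G.pos b - G.pos n) := by
    rw [cwAngle_self]
    -- The extra `-1` appears because equal directions are at angle `2π`, not `0`.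
    refine cwAngle_eq_of_arg Real.two_pi_pos le_rfl (k - l - 1) ?_
    push_cast
    linarith
  exact (hG.eq_of_cwAngle_eq hb' hb h4).symm

/-- The rotation at a node is transitive on its neighbors. -/
theorem forall_adj_of_isNext_closed [Finite V] (hG : G.Planar) {n b : V} (P : V → Prop)
    (hb : G.graph.Adj n b) (hPb : P b)
    (hP : ∀ x y, G.graph.Adj n x → P x → G.IsNext Hand.R n x y → P y) :
    ∀ y, G.graph.Adj n y → P y := by
  intro y hy
  -- Among the neighbors with `P`, take the last one before `y` clockwise: its successor is `y`, for
  -- otherwise it would be closer to `y` and also satisfy `P`.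
  obtain ⟨x, ⟨hx, hPx⟩, hmin⟩ := Set.exists_min_image {x | G.graph.Adj n x ∧ P x}
    (fun x => cwAngle (G.pos x - G.pos n) (G.pos y - G.pos n)) (Set.toFinite _) ⟨b, hb, hPb⟩
  obtain ⟨z, hz⟩ := exists_isNext (G := G) hx
  have hPz := hP x z hx hPx hz
  rcases (hz.2 y hy).lt_or_eq with h | h
  · have h1 := cwAngle_sub_left h
    have h2 := hmin z ⟨hz.1, hPz⟩
    linarith [cwAngle_pos (G.pos x - G.pos n) (G.pos z - G.pos n)]
  · exact hG.eq_of_cwAngle_eq hz.1 hy h ▸ hPz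

end GeometricGraph

end TwoFace

/-! ### Faces near edges and nodes. -/

namespace TwoFace

/-- For `0 < l < 1` these bounds place `l * exp (η * I)` in the strip with real part in `[l / 2, l]`
and imaginary part in `(0, δ)`. -/
theorem exists_small_angle {α δ : ℝ} (hα : 0 < α) (hδ : 0 < δ) :
    ∃ η : ℝ, 0 < η ∧ η < α ∧ 1 / 2 < Real.cos η ∧ 0 < Real.sin η ∧ Real.sin η < δ := by
  have e1 : ∀ᶠ η in nhdsWithin (0 : ℝ) (Set.Ioi 0), 1 / 2 < Real.cos η :=
    nhdsWithin_le_nhds (Real.continuous_cos.continuousAt.eventually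
      (lt_mem_nhds (by norm_num)))
  have e2 : ∀ᶠ η in nhdsWithin (0 : ℝ) (Set.Ioi 0), Real.sin η < δ :=
    nhdsWithin_le_nhds (Real.continuous_sin.continuousAt.eventually
      (gt_mem_nhds (by simpa using hδ)))
  have e3 : ∀ᶠ η in nhdsWithin (0 : ℝ) (Set.Ioi 0), η ∈ Set.Ioo 0 α := Ioo_mem_nhdsGT hα
  have e4 : ∀ᶠ η in nhdsWithin (0 : ℝ) (Set.Ioi 0), η ∈ Set.Ioo 0 Real.pi :=
    Ioo_mem_nhdsGT Real.pi_pos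
  obtain ⟨η, h1, h2, h3, h4⟩ := (e1.and (e2.and (e3.and e4))).exists
  exact ⟨η, h3.1, h3.2, h1, Real.sin_pos_of_pos_of_lt_pi h4.1 h4.2, h2⟩

namespace GeometricGraph

variable {V : Type*} {G : GeometricGraph V}

/-- The point with coordinate `w` in the complex coordinate in which the dart from `a` to `b` runs
from `0` to `1`. -/
def dartPoint (G : GeometricGraph V) (a b : V) (w : ℂ) : ℂ := G.pos a + w * (G.pos b - G.pos a)

theorem dartPoint_symm (a b : V) (w : ℂ) : G.dartPoint a b w = G.dartPoint b a (1 - w) := by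
  simp only [dartPoint]; ring

theorem continuous_dartPoint (a b : V) : Continuous (G.dartPoint a b) := by
  unfold dartPoint; fun_prop

theorem dist_dartPoint (a b : V) (w w' : ℂ) :
    dist (G.dartPoint a b w) (G.dartPoint a b w') = dist w w' * ‖G.pos b - G.pos a‖ := by
  rw [dist_eq_norm, dist_eq_norm, ← norm_mul, dartPoint, dartPoint]
  ring_nf

theorem dartPoint_mem_edgeSeg_iff {a b : V} (h : a ≠ b) {w : ℂ} :
    G.dartPoint a b w ∈ G.edgeSeg a b ↔ w.im = 0 ∧ 0 ≤ w.re ∧ w.re ≤ 1 := by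
  rw [mem_edgeSeg_iff]
  constructor
  · rintro ⟨t, h0, h1, ht⟩
    have hw : w = t := mul_right_cancel₀ (pos_sub_ne_zero (G := G) h.symm)
      (by simpa [dartPoint] using ht)
    simp [hw, h0, h1]
  · rintro ⟨h, h0, h1⟩
    refine ⟨w.re, h0, h1, ?_⟩
    rw [dartPoint, ← Complex.ext (z := w) (w := w.re) (by simp) (by simp [h])]

theorem isClosed_edgeSeg (a b : V) : IsClosed (G.edgeSeg a b) := by
  rw [edgeSeg, segment_eq_image']
  exact (isCompact_Icc.image (by fun_prop)).isClosed

theorem isClosed_iUnion_edgeSeg [Finite V] (P : V → V → Prop) :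
    IsClosed {z | ∃ a b, P a b ∧ z ∈ G.edgeSeg a b} := by
  have : {z | ∃ a b, P a b ∧ z ∈ G.edgeSeg a b} =
      ⋃ p : {p : V × V // P p.1 p.2}, G.edgeSeg p.1.1 p.1.2 := by
    ext z; simp
  rw [this]
  exact isClosed_iUnion_of_finite fun _ => isClosed_edgeSeg _ _

theorem isClosed_drawing [Finite V] : IsClosed G.drawing := isClosed_iUnion_edgeSeg _

theorem IsFace.isOpen [Finite V] {F : Set ℂ} (hF : G.IsFace F) : IsOpen F := by
  obtain ⟨z, -, rfl⟩ := hF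
  exact isClosed_drawing.isOpen_compl.pathComponentIn z

theorem IsFace.subset_compl {F : Set ℂ} (hF : G.IsFace F) : F ⊆ G.drawingᶜ := by
  obtain ⟨z, -, rfl⟩ := hF
  exact pathComponentIn_subset

theorem IsFace.eq_pathComponentIn {F : Set ℂ} (hF : G.IsFace F) {z : ℂ} (hz : z ∈ F) :
    F = pathComponentIn G.drawingᶜ z := by
  obtain ⟨z', -, rfl⟩ := hF
  exact (pathComponentIn_congr hz).symm

theorem IsFace.eq_of_mem {F F' : Set ℂ} (hF : G.IsFace F) (hF' : G.IsFace F') {z : ℂ}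
    (hz : z ∈ F) (hz' : z ∈ F') : F = F' := by
  rw [hF.eq_pathComponentIn hz, hF'.eq_pathComponentIn hz']

theorem IsFace.subset_of_isPathConnected {F S : Set ℂ} (hF : G.IsFace F)
    (hS : IsPathConnected S) (hSG : S ⊆ G.drawingᶜ) {z : ℂ} (hz : z ∈ F) (hzS : z ∈ S) :
    S ⊆ F := by
  rw [hF.eq_pathComponentIn hz]
  exact hS.subset_pathComponentIn hzS hSG

theorem isFace_pathComponentIn {z : ℂ} (hz : z ∉ G.drawing) :
    G.IsFace (pathComponentIn G.drawingᶜ z) := ⟨z, hz, rfl⟩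

theorem Planar.eq_or_eq_of_pos_mem_edgeSeg (hG : G.Planar) {n b c e : V}
    (hb : G.graph.Adj n b) (hce : G.graph.Adj c e) (h : G.pos n ∈ G.edgeSeg c e) :
    n = c ∨ n = e := by
  by_cases hne : s(n, b) = s(c, e)
  · have : n ∈ s(c, e) := hne ▸ Sym2.mem_mk_left n b
    simpa using this
  · obtain ⟨x, ⟨-, hx⟩, hxn⟩ := hG n b c e hb hce hne ⟨left_mem_segment _ _ _, h⟩
    obtain rfl := G.pos_injective hxn
    simpa using hx

/-- A compact part of the interior of an edge has a neighborhood that contains no point of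
another edge. -/
theorem Planar.exists_strip [Finite V] (hG : G.Planar) {a b : V} (hab : G.graph.Adj a b)
    {t₀ t₁ : ℝ} (h₀ : 0 < t₀) (h₁ : t₁ < 1) :
    ∃ δ > 0, ∀ w : ℂ, t₀ ≤ w.re → w.re ≤ t₁ → |w.im| < δ → w.im ≠ 0 →
      G.dartPoint a b w ∉ G.drawing := by
  -- The closed union `E` of all other edges misses the compact part `K` of this edge, so a
  -- thickening of `K` misses `E` as well.
  set E : Set ℂ := {z | ∃ c e, (G.graph.Adj c e ∧ s(a, b) ≠ s(c, e)) ∧ z ∈ G.edgeSeg c e} with hE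
  have hEc : IsClosed E := isClosed_iUnion_edgeSeg _
  set K : Set ℂ := (fun t : ℝ => G.dartPoint a b t) '' Set.Icc t₀ t₁ with hK
  have hKc : IsCompact K := isCompact_Icc.image
    ((continuous_dartPoint a b).comp Complex.continuous_ofReal)
  have hKE : K ⊆ Eᶜ := by
    rintro _ ⟨t, ht, rfl⟩ ⟨c, e, ⟨hce, hne⟩, hmem⟩
    have hmem' : G.dartPoint a b t ∈ G.edgeSeg a b :=
      (dartPoint_mem_edgeSeg_iff hab.ne).2 ⟨by simp, by simpa using h₀.le.trans ht.1,
        by simpa using ht.2.trans h₁.le⟩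
    obtain ⟨x, ⟨hx, -⟩, hxz⟩ := hG a b c e hab hce hne ⟨hmem', hmem⟩
    have hne := pos_sub_ne_zero_of_adj hab
    rcases hx with rfl | rfl
    · have h : (t : ℂ) * (G.pos b - G.pos x) = 0 := by
        simp only [dartPoint] at hxz; linear_combination -hxz
      have : t = 0 := by simpa [hne] using h
      linarith [ht.1]
    · have h : (1 - t : ℂ) * (G.pos x - G.pos a) = 0 := by
        simp only [dartPoint] at hxz; linear_combination hxz
      have : (1 : ℂ) - t = 0 := (mul_eq_zero.1 h).resolve_right hne
      have : (t : ℂ) = (1 : ℝ) := by push_cast; linear_combination -this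
      have := Complex.ofReal_injective this
      linarith [ht.2]
  obtain ⟨δ, hδ, hsub⟩ := hKc.exists_thickening_subset_open hEc.isOpen_compl hKE
  have hpos : 0 < ‖G.pos b - G.pos a‖ := norm_pos_iff.2 (pos_sub_ne_zero_of_adj hab)
  refine ⟨δ / ‖G.pos b - G.pos a‖, by positivity, fun w hw₀ hw₁ hwδ hw ⟨c, e, hce, hmem⟩ => ?_⟩
  by_cases hne : s(a, b) = s(c, e)
  · have : G.dartPoint a b w ∈ G.edgeSeg a b := by
      rcases Sym2.eq_iff.1 hne with ⟨rfl, rfl⟩ | ⟨rfl, rfl⟩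
      · exact hmem
      · rwa [edgeSeg_comm]
    exact hw ((dartPoint_mem_edgeSeg_iff hab.ne).1 this).1
  · refine hsub (Metric.mem_thickening_iff.2 ⟨_, ⟨w.re, ⟨hw₀, hw₁⟩, rfl⟩, ?_⟩)
      ⟨c, e, ⟨hce, hne⟩, hmem⟩
    rw [dist_dartPoint]
    have : dist w w.re = |w.im| := by
      rw [dist_eq_norm, show w - w.re = w.im * Complex.I by
        linear_combination (Complex.re_add_im w).symm]
      simp
    rw [this]
    exact (lt_div_iff₀ hpos).1 hwδ

/-- The open rectangle to the left of a part of the dart from `a` to `b`. -/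
def leftStrip (G : GeometricGraph V) (a b : V) (t₀ t₁ δ : ℝ) : Set ℂ :=
  G.dartPoint a b '' {w | t₀ ≤ w.re ∧ w.re ≤ t₁ ∧ 0 < w.im ∧ w.im < δ}

theorem isPathConnected_leftStrip (a b : V) {t₀ t₁ δ : ℝ} (ht : t₀ ≤ t₁) (hδ : 0 < δ) :
    IsPathConnected (G.leftStrip a b t₀ t₁ δ) := by
  refine IsPathConnected.image (Convex.isPathConnected ?_ ?_) (continuous_dartPoint a b)
  · have : {w : ℂ | t₀ ≤ w.re ∧ w.re ≤ t₁ ∧ 0 < w.im ∧ w.im < δ} =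
        Complex.reLm ⁻¹' Set.Icc t₀ t₁ ∩ Complex.imLm ⁻¹' Set.Ioo 0 δ := by
      ext w; simp [and_assoc]
    rw [this]
    exact ((convex_Icc _ _).linear_preimage _).inter ((convex_Ioo _ _).linear_preimage _)
  · exact ⟨⟨t₀, δ / 2⟩, le_rfl, ht, by simpa using hδ, by simpa using half_lt_self hδ⟩

theorem midpoint_add_eq_dartPoint (a b : V) (ε : ℝ) :
    midpoint ℝ (G.pos a) (G.pos b) + (ε : ℂ) * (Complex.I * (G.pos b - G.pos a)) =
      G.dartPoint a b (1 / 2 + ε * Complex.I) := by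
  rw [midpoint_eq_smul_add, dartPoint, Complex.real_smul]
  simp only [invOf_eq_inv]
  push_cast
  ring

theorem leftOf_iff {a b : V} {F : Set ℂ} : G.LeftOf a b F ↔
    ∃ δ > 0, ∀ ε : ℝ, 0 < ε → ε < δ → G.dartPoint a b (1 / 2 + ε * Complex.I) ∈ F := by
  simp only [LeftOf, midpoint_add_eq_dartPoint]
  rw [eventually_nhdsWithin_iff, Metric.eventually_nhds_iff]
  constructor
  · rintro ⟨δ, hδ, h⟩
    exact ⟨δ, hδ, fun ε h0 h1 => h (by simpa [abs_of_pos h0] using h1) h0⟩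
  · rintro ⟨δ, hδ, h⟩
    exact ⟨δ, hδ, fun ε h1 h0 => h ε h0 (by
      simpa [abs_of_pos (show (0 : ℝ) < ε from h0)] using h1)⟩

theorem Planar.exists_leftOf [Finite V] (hG : G.Planar) {a b : V} (hab : G.graph.Adj a b) :
    ∃ F, G.IsFace F ∧ G.LeftOf a b F := by
  obtain ⟨δ, hδ, h⟩ := hG.exists_strip hab (t₀ := 1 / 2) (t₁ := 1 / 2) (by norm_num) (by norm_num)
  have hsub : G.leftStrip a b (1 / 2) (1 / 2) δ ⊆ G.drawingᶜ := by
    rintro _ ⟨w, ⟨h0, h1, h2, h3⟩, rfl⟩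
    exact h w h0 h1 (by rwa [abs_of_pos h2]) h2.ne'
  have hmem : ∀ ε : ℝ, 0 < ε → ε < δ →
      G.dartPoint a b (1 / 2 + ε * Complex.I) ∈ G.leftStrip a b (1 / 2) (1 / 2) δ :=
    fun ε h0 h1 => ⟨_, ⟨by simp, by simp, by simpa using h0, by simpa using h1⟩, rfl⟩
  have hp := hmem (δ / 2) (by linarith) (by linarith)
  refine ⟨_, isFace_pathComponentIn (hsub hp), leftOf_iff.2 ⟨δ, hδ, fun ε h0 h1 => ?_⟩⟩
  exact (isPathConnected_leftStrip a b le_rfl hδ).subset_pathComponentIn hp hsub (hmem ε h0 h1)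

theorem LeftOf.unique {a b : V} {F F' : Set ℂ} (hF : G.IsFace F) (hF' : G.IsFace F')
    (h : G.LeftOf a b F) (h' : G.LeftOf a b F') : F = F' := by
  obtain ⟨ε, h1, h2⟩ := (Filter.Eventually.and h h').exists
  exact hF.eq_of_mem hF' h1 h2

/-- The face on the left of the dart from `a` to `b`. -/
def leftFace (G : GeometricGraph V) (a b : V) : Set ℂ :=
  Classical.epsilon fun F => G.IsFace F ∧ G.LeftOf a b F

section

variable [Finite V]

theorem Planar.isFace_leftFace (hG : G.Planar) {a b : V} (hab : G.graph.Adj a b) :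
    G.IsFace (G.leftFace a b) :=
  (Classical.epsilon_spec (hG.exists_leftOf hab)).1

theorem Planar.leftOf_leftFace (hG : G.Planar) {a b : V} (hab : G.graph.Adj a b) :
    G.LeftOf a b (G.leftFace a b) :=
  (Classical.epsilon_spec (hG.exists_leftOf hab)).2

theorem Planar.leftOf_iff_eq_leftFace (hG : G.Planar) {a b : V} (hab : G.graph.Adj a b)
    {F : Set ℂ} (hF : G.IsFace F) : G.LeftOf a b F ↔ F = G.leftFace a b :=
  ⟨fun h => h.unique hF (hG.isFace_leftFace hab) (hG.leftOf_leftFace hab),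
    fun h => h ▸ hG.leftOf_leftFace hab⟩

theorem Planar.exists_leftStrip (hG : G.Planar) {a b : V} (hab : G.graph.Adj a b)
    {t₀ t₁ : ℝ} (h₀ : 0 < t₀) (h₁ : t₁ < 1) :
    ∃ δ > 0, G.leftStrip a b t₀ t₁ δ ⊆ G.leftFace a b := by
  -- The strip is extended to the abscissa `1 / 2`, the only place where `LeftOf` fixes the face;
  -- connectedness carries the face along the strip.
  obtain ⟨δ, hδ, h⟩ := hG.exists_strip hab (t₀ := min t₀ (1 / 2)) (t₁ := max t₁ (1 / 2))
    (by positivity) (max_lt h₁ (by norm_num))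
  have hsub : G.leftStrip a b (min t₀ (1 / 2)) (max t₁ (1 / 2)) δ ⊆ G.drawingᶜ := by
    rintro _ ⟨w, ⟨h0, h1, h2, h3⟩, rfl⟩
    exact h w h0 h1 (by rwa [abs_of_pos h2]) h2.ne'
  refine ⟨δ, hδ, ?_⟩
  obtain ⟨η, hη, hmem⟩ := leftOf_iff.1 (hG.leftOf_leftFace hab)
  have hpos : 0 < min η δ := lt_min hη hδ
  refine subset_trans ?_ ((hG.isFace_leftFace hab).subset_of_isPathConnected
    (isPathConnected_leftStrip a b ?_ hδ) hsub
    (hmem (min η δ / 2) (by linarith) (by linarith [min_le_left η δ])) ?_)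
  · refine Set.image_mono ?_
    rintro w ⟨h0, h1, h2, h3⟩
    exact ⟨(min_le_left _ _).trans h0, h1.trans (le_max_left _ _), h2, h3⟩
  · exact (min_le_right _ _).trans (le_max_right _ _)
  · refine ⟨_, ⟨?_, ?_, ?_, ?_⟩, rfl⟩
    · simp
    · simp
    · simpa using ⟨hη, hδ⟩
    · have : min η δ / 2 < δ := by linarith [min_le_right η δ]
      simpa using this

/-- Each interior point of the edge is a limit of points of a left strip; the end points follow on
taking closures. -/
theorem Planar.edgeSeg_subset_closure (hG : G.Planar) {a b : V} (hab : G.graph.Adj a b) :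
    G.edgeSeg a b ⊆ closure (G.leftFace a b) := by
  rw [edgeSeg, ← closure_openSegment]
  refine closure_minimal ?_ isClosed_closure
  rw [openSegment_eq_image']
  rintro _ ⟨t, ⟨h0, h1⟩, rfl⟩
  obtain ⟨δ, hδ, h⟩ := hG.exists_leftStrip hab h0 h1
  have hlim : Filter.Tendsto (fun ε : ℝ => G.dartPoint a b (t + ε * Complex.I))
      (nhdsWithin 0 (Set.Ioi 0)) (nhds (G.dartPoint a b (t + (0 : ℝ) * Complex.I))) := by
    have : Continuous (fun ε : ℝ => G.dartPoint a b (t + ε * Complex.I)) :=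
      (continuous_dartPoint a b).comp (by fun_prop)
    exact (this.tendsto 0).mono_left nhdsWithin_le_nhds
  have heq : G.pos a + t • (G.pos b - G.pos a) = G.dartPoint a b (t + (0 : ℝ) * Complex.I) := by
    simp [dartPoint]
  simp only [heq]
  refine mem_closure_of_tendsto hlim ?_
  filter_upwards [Ioo_mem_nhdsGT hδ] with ε hε
  exact h ⟨_, ⟨by simp, by simp, by simpa using hε.1, by simpa using hε.2⟩, rfl⟩

/-- Near an interior point of an edge there are only the two faces at this edge. -/
theorem Planar.exists_ball_edge (hG : G.Planar) {a b : V} (hab : G.graph.Adj a b) {t : ℝ}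
    (h0 : 0 < t) (h1 : t < 1) :
    ∃ ρ > 0, ∀ z, dist z (G.dartPoint a b t) < ρ →
      z ∈ G.edgeSeg a b ∨ z ∈ G.leftFace a b ∨ z ∈ G.leftFace b a := by
  obtain ⟨δ, hδ, h⟩ := hG.exists_leftStrip hab (t₀ := t / 2) (t₁ := (1 + t) / 2)
    (by linarith) (by linarith)
  obtain ⟨δ', hδ', h'⟩ := hG.exists_leftStrip hab.symm (t₀ := (1 - t) / 2) (t₁ := 1 - t / 2)
    (by linarith) (by linarith)
  -- In dart coordinates the disc of radius `η` about `t` then lies in the union of the edge and the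
  -- strips on its two sides.
  set η := min (min δ δ') (min (t / 2) ((1 - t) / 2)) with hη
  have hη0 : 0 < η := lt_min (lt_min hδ hδ') (lt_min (by linarith) (by linarith))
  have hη1 : η ≤ δ := (min_le_left _ _).trans (min_le_left _ _)
  have hη2 : η ≤ δ' := (min_le_left _ _).trans (min_le_right _ _)
  have hη3 : η ≤ t / 2 := (min_le_right _ _).trans (min_le_left _ _)
  have hη4 : η ≤ (1 - t) / 2 := (min_le_right _ _).trans (min_le_right _ _)
  have hne := pos_sub_ne_zero_of_adj hab
  have hpos : 0 < ‖G.pos b - G.pos a‖ := norm_pos_iff.2 hne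
  refine ⟨η * ‖G.pos b - G.pos a‖, by positivity, fun z hz => ?_⟩
  obtain ⟨w, rfl⟩ : ∃ w, z = G.dartPoint a b w :=
    ⟨(z - G.pos a) / (G.pos b - G.pos a), by rw [dartPoint]; field_simp; ring⟩
  rw [dist_dartPoint] at hz
  have hw := lt_of_mul_lt_mul_right hz hpos.le
  rw [dist_eq_norm] at hw
  have hre := abs_lt.1 ((Complex.abs_re_le_norm _).trans_lt hw)
  have him := abs_lt.1 ((Complex.abs_im_le_norm _).trans_lt hw)
  simp only [Complex.sub_re, Complex.sub_im, Complex.ofReal_re, Complex.ofReal_im, sub_zero]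
    at hre him
  rcases lt_trichotomy w.im 0 with hi | hi | hi
  · right; right
    rw [dartPoint_symm]
    refine h' ⟨_, ⟨?_, ?_, ?_, ?_⟩, rfl⟩ <;> simp <;> linarith
  · left
    exact (dartPoint_mem_edgeSeg_iff hab.ne).2 ⟨hi, by linarith, by linarith⟩
  · right; left
    refine h ⟨_, ⟨?_, ?_, ?_, ?_⟩, rfl⟩ <;> linarith

theorem Planar.eq_leftFace_of_mem_closure (hG : G.Planar) {a b : V} (hab : G.graph.Adj a b)
    {t : ℝ} (h0 : 0 < t) (h1 : t < 1) {F : Set ℂ} (hF : G.IsFace F)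
    (h : G.dartPoint a b t ∈ closure F) : F = G.leftFace a b ∨ F = G.leftFace b a := by
  obtain ⟨ρ, hρ, hball⟩ := hG.exists_ball_edge hab h0 h1
  obtain ⟨z, hz, hzρ⟩ := Metric.mem_closure_iff.1 h ρ hρ
  rw [dist_comm] at hzρ
  rcases hball z hzρ with h | h | h
  · exact absurd ⟨a, b, hab, h⟩ (hF.subset_compl hz)
  · exact Or.inl (hF.eq_of_mem (hG.isFace_leftFace hab) hz h)
  · exact Or.inr (hF.eq_of_mem (hG.isFace_leftFace hab.symm) hz h)

/-- A disc around a node that meets only the edges at this node, and none of its neighbors. -/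
theorem Planar.exists_ball_node (hG : G.Planar) {n b : V} (hb : G.graph.Adj n b) :
    ∃ ρ > 0, (∀ x, G.graph.Adj n x → ρ < ‖G.pos x - G.pos n‖) ∧
      ∀ z, dist z (G.pos n) < ρ → z ∈ G.drawing → ∃ x, G.graph.Adj n x ∧ z ∈ G.edgeSeg n x := by
  set E : Set ℂ := {z | ∃ c e, (G.graph.Adj c e ∧ n ≠ c ∧ n ≠ e) ∧ z ∈ G.edgeSeg c e} with hE
  have hEc : IsClosed E := isClosed_iUnion_edgeSeg _
  have hn : G.pos n ∈ Eᶜ := by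
    rintro ⟨c, e, ⟨hce, h1, h2⟩, hmem⟩
    rcases hG.eq_or_eq_of_pos_mem_edgeSeg hb hce hmem with h | h
    · exact h1 h
    · exact h2 h
  obtain ⟨ρ, hρ, hsub⟩ := Metric.isOpen_iff.1 hEc.isOpen_compl _ hn
  obtain ⟨x, hx, hmin⟩ := Set.exists_min_image {x | G.graph.Adj n x}
    (fun x => ‖G.pos x - G.pos n‖) (Set.toFinite _) ⟨b, hb⟩
  have hpos : 0 < ‖G.pos x - G.pos n‖ := norm_pos_iff.2 (pos_sub_ne_zero_of_adj hx)
  refine ⟨min ρ (‖G.pos x - G.pos n‖ / 2), lt_min hρ (by linarith), fun y hy => ?_,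
    fun z hz ⟨c, e, hce, hmem⟩ => ?_⟩
  · have := hmin y hy
    have := min_le_right ρ (‖G.pos x - G.pos n‖ / 2)
    linarith
  · by_cases h1 : n = c
    · subst h1
      exact ⟨e, hce, hmem⟩
    by_cases h2 : n = e
    · subst h2
      exact ⟨c, hce.symm, by rwa [edgeSeg_comm]⟩
    exact absurd ⟨c, e, ⟨hce, h1, h2⟩, hmem⟩ (hsub (hz.trans_le (min_le_left _ _)))

/-- Near a node, the angle that precedes the edge to `c` clockwise belongs to the face on the left
of the dart to `c`. -/
theorem Planar.mem_leftFace_of_minimal (hG : G.Planar) {n c : V} (hc : G.graph.Adj n c) {ρ : ℝ}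
    (hρ : ∀ x, G.graph.Adj n x → ρ < ‖G.pos x - G.pos n‖)
    (hball : ∀ z, dist z (G.pos n) < ρ → z ∈ G.drawing →
      ∃ x, G.graph.Adj n x ∧ z ∈ G.edgeSeg n x)
    {z : ℂ} (hz : dist z (G.pos n) < ρ) (hzd : z ∉ G.drawing)
    (hmin : ∀ c', G.graph.Adj n c' →
      cwAngle (z - G.pos n) (G.pos c - G.pos n) ≤ cwAngle (z - G.pos n) (G.pos c' - G.pos n)) :
    z ∈ G.leftFace n c := by
  have hcn := pos_sub_ne_zero_of_adj hc
  have hzn : z - G.pos n ≠ 0 := by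
    intro h
    rw [sub_eq_zero] at h
    exact hzd ⟨n, c, hc, h ▸ left_mem_segment _ _ _⟩
  set α := cwAngle (z - G.pos n) (G.pos c - G.pos n) with hα
  have hα0 : 0 < α := cwAngle_pos _ _
  have hα1 : α ≤ 2 * Real.pi := cwAngle_le _ _
  obtain ⟨r, hr, hrc⟩ := exists_eq_mul_exp_cwAngle hzn hcn
  rw [← hα] at hrc
  -- Rotate `z` clockwise about `n` until just before the edge to `c`. By minimality this arc
  -- crosses no edge, and its last part lies in the left strip of the dart to `c`.
  set f : ℝ → ℂ := fun θ => G.pos n + (z - G.pos n) * Complex.exp (-(θ * Complex.I)) with hf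
  have hfcont : Continuous f := by fun_prop
  have hnorm : ∀ θ : ℝ, ‖Complex.exp (-(θ * Complex.I))‖ = 1 := fun θ => by
    rw [show -(θ * Complex.I) = ((-θ : ℝ) : ℂ) * Complex.I by push_cast; ring,
      Complex.norm_exp_ofReal_mul_I]
  have harc : f '' Set.Ico 0 α ⊆ G.drawingᶜ := by
    rintro _ ⟨θ, ⟨h0, h1⟩, rfl⟩ hmem
    rcases h0.eq_or_lt with rfl | h0
    · apply hzd
      simpa [hf] using hmem
    obtain ⟨x, hx, hxm⟩ := hball (f θ) (by
      rw [dist_eq_norm] at hz ⊢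
      simpa [hf, hnorm] using hz) hmem
    obtain ⟨t, ht0, -, ht⟩ := mem_edgeSeg_iff.1 hxm
    have ht' : (z - G.pos n) * Complex.exp (-(θ * Complex.I)) = t * (G.pos x - G.pos n) := by
      simp only [hf] at ht; linear_combination ht
    have ht0' : t ≠ 0 := by
      rintro rfl
      simp [hzn] at ht'
    have htpos : 0 < t := lt_of_le_of_ne ht0 (Ne.symm ht0')
    have hxeq : G.pos x - G.pos n =
        (t⁻¹ : ℝ) * (z - G.pos n) * Complex.exp (-(θ * Complex.I)) := by
      rw [mul_assoc, ht']
      push_cast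
      rw [inv_mul_cancel_left₀ (by exact_mod_cast ht0')]
    have := hmin x hx
    rw [hxeq, cwAngle_mul_exp_neg hzn (by positivity) h0 (h1.le.trans hα1)] at this
    linarith
  have hrlt : 1 < r := by
    have h1 : ‖G.pos c - G.pos n‖ = r * ‖z - G.pos n‖ := by
      rw [hrc, norm_mul, norm_mul, hnorm]; simp [abs_of_pos hr]
    have h2 := hρ c hc
    rw [dist_eq_norm] at hz
    have h3 : 0 < ‖z - G.pos n‖ := norm_pos_iff.2 hzn
    by_contra! hle
    nlinarith
  -- The full rotation would reach the edge to `c` at parameter `l`; it is less than `1` because the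
  -- disc contains no neighbor.
  set l := r⁻¹ with hl
  have hl0 : 0 < l := by positivity
  have hl1 : l < 1 := inv_lt_one_of_one_lt₀ hrlt
  obtain ⟨δ, hδ, hstrip⟩ := hG.exists_leftStrip hc (t₀ := l / 2) (t₁ := l) (by linarith) hl1
  obtain ⟨η, hη0, hηα, hηc, hηs, hηs'⟩ := exists_small_angle hα0 hδ
  have hpt : f (α - η) = G.dartPoint n c (l * Complex.exp (η * Complex.I)) := by
    have hrC : (r : ℂ) ≠ 0 := by exact_mod_cast hr.ne'
    simp only [hf, dartPoint]
    rw [hrc, hl]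
    push_cast
    rw [show -((↑α - ↑η : ℂ) * Complex.I) = -(α * Complex.I) + η * Complex.I by ring,
      Complex.exp_add]
    field_simp
  have hpt' : f (α - η) ∈ G.leftFace n c := by
    rw [hpt]
    apply hstrip
    have hcos := Real.cos_le_one η
    refine ⟨_, ⟨?_, ?_, ?_, ?_⟩, rfl⟩
    · rw [Complex.re_ofReal_mul, Complex.exp_ofReal_mul_I_re]
      nlinarith
    · rw [Complex.re_ofReal_mul, Complex.exp_ofReal_mul_I_re]
      nlinarith
    · rw [Complex.im_ofReal_mul, Complex.exp_ofReal_mul_I_im]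
      positivity
    · rw [Complex.im_ofReal_mul, Complex.exp_ofReal_mul_I_im]
      nlinarith
  refine (hG.isFace_leftFace hc).subset_of_isPathConnected
    (((convex_Ico 0 α).isPathConnected ⟨0, le_rfl, hα0⟩).image hfcont) harc hpt'
    ⟨α - η, ⟨by linarith, by linarith⟩, rfl⟩ ⟨0, ⟨le_rfl, hα0⟩, by simp [hf]⟩

/-- The faces at a node are those on the left of the outgoing darts. -/
theorem Planar.exists_ball_leftFace (hG : G.Planar) {n b : V} (hb : G.graph.Adj n b) :
    ∃ ρ > 0, ∀ z, dist z (G.pos n) < ρ →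
      ∃ x, G.graph.Adj n x ∧ (z ∈ G.edgeSeg n x ∨ z ∈ G.leftFace n x) := by
  obtain ⟨ρ, hρ, hρx, hball⟩ := hG.exists_ball_node hb
  refine ⟨ρ, hρ, fun z hz => ?_⟩
  by_cases hzd : z ∈ G.drawing
  · obtain ⟨x, hx, h⟩ := hball z hz hzd
    exact ⟨x, hx, Or.inl h⟩
  · obtain ⟨c, hc, hmin⟩ := exists_minimal_cwAngle (G := G) (z - G.pos n) hb
    exact ⟨c, hc, Or.inr (hG.mem_leftFace_of_minimal hc hρx hball hz hzd hmin)⟩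

theorem Planar.exists_eq_leftFace_of_nodeBorders (hG : G.Planar) {n b : V}
    (hb : G.graph.Adj n b) {F : Set ℂ} (hF : G.IsFace F) (h : G.NodeBorders n F) :
    ∃ x, G.graph.Adj n x ∧ F = G.leftFace n x := by
  obtain ⟨ρ, hρ, hball⟩ := hG.exists_ball_leftFace hb
  obtain ⟨z, hz, hzρ⟩ := Metric.mem_closure_iff.1 h ρ hρ
  rw [dist_comm] at hzρ
  obtain ⟨x, hx, h | h⟩ := hball z hzρ
  · exact absurd ⟨n, x, hx, h⟩ (hF.subset_compl hz)
  · exact ⟨x, hx, hF.eq_of_mem (hG.isFace_leftFace hx) hz h⟩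

/-- Passing a corner does not change the face on the left. -/
theorem Planar.leftFace_eq_of_isNext (hG : G.Planar) {n b c : V} (hb : G.graph.Adj n b)
    (h : G.IsNext Hand.R n b c) : G.leftFace b n = G.leftFace n c := by
  obtain ⟨ρ, hρ, hρx, hball⟩ := hG.exists_ball_node hb
  have hbn := pos_sub_ne_zero_of_adj hb
  have hnb : 0 < ‖G.pos b - G.pos n‖ := norm_pos_iff.2 hbn
  -- This places the test point `G.pos n + u` at distance `ρ / 2` from `n`. It is turned clockwise
  -- off the edge to `b` by so small an `η` that it lies left of the dart from `b` and before the
  -- edge to `c`.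
  set l := ρ / (2 * ‖G.pos b - G.pos n‖) with hl
  have hl0 : 0 < l := by positivity
  have hl1 : l < 1 := by
    rw [hl, div_lt_one (by positivity)]
    linarith [hρx b hb]
  obtain ⟨δ, hδ, hstrip⟩ := hG.exists_leftStrip hb.symm (t₀ := 1 - l) (t₁ := 1 - l / 2)
    (by linarith) (by linarith)
  have hcpos := cwAngle_pos (G.pos b - G.pos n) (G.pos c - G.pos n)
  obtain ⟨η, hη0, hηα, hηc, hηs, hηs'⟩ := exists_small_angle hcpos hδ
  set u : ℂ := l * (G.pos b - G.pos n) * Complex.exp (-(η * Complex.I)) with hu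
  have hexp : Complex.exp (-(η * Complex.I)) = Complex.exp (((-η : ℝ) : ℂ) * Complex.I) := by
    push_cast; ring_nf
  have hz : G.pos n + u ∈ G.leftFace b n := by
    have : G.pos n + u = G.dartPoint n b (l * Complex.exp (((-η : ℝ) : ℂ) * Complex.I)) := by
      rw [dartPoint, hu, hexp]; ring
    rw [this, dartPoint_symm]
    apply hstrip
    have hcos := Real.cos_le_one η
    refine ⟨_, ⟨?_, ?_, ?_, ?_⟩, rfl⟩
    · rw [Complex.sub_re, Complex.re_ofReal_mul, Complex.exp_ofReal_mul_I_re, Real.cos_neg]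
      simp only [Complex.one_re]
      nlinarith
    · rw [Complex.sub_re, Complex.re_ofReal_mul, Complex.exp_ofReal_mul_I_re, Real.cos_neg]
      simp only [Complex.one_re]
      nlinarith
    · rw [Complex.sub_im, Complex.im_ofReal_mul, Complex.exp_ofReal_mul_I_im, Real.sin_neg]
      simp only [Complex.one_im]
      nlinarith
    · rw [Complex.sub_im, Complex.im_ofReal_mul, Complex.exp_ofReal_mul_I_im, Real.sin_neg]
      simp only [Complex.one_im]
      nlinarith
  have hcu : cwAngle (G.pos b - G.pos n) u = η :=
    cwAngle_mul_exp_neg hbn hl0 hη0 (hηα.le.trans (cwAngle_le _ _))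
  refine (hG.isFace_leftFace hb.symm).eq_of_mem (hG.isFace_leftFace h.1) hz
    (hG.mem_leftFace_of_minimal h.1 hρx hball ?_
      ((hG.isFace_leftFace hb.symm).subset_compl hz) fun c' hc' => ?_)
  · rw [dist_eq_norm, add_sub_cancel_left, hu, hexp, norm_mul, norm_mul,
      Complex.norm_exp_ofReal_mul_I, Complex.norm_real, Real.norm_of_nonneg hl0.le, hl, mul_one]
    rw [div_mul_eq_mul_div, div_lt_iff₀ (by positivity)]
    nlinarith
  · have h1 := h.2 c' hc'
    simp only [Hand.sweep] at h1
    rw [add_sub_cancel_left, cwAngle_sub_left (u := G.pos b - G.pos n) (by rw [hcu]; exact hηα),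
      cwAngle_sub_left (u := G.pos b - G.pos n) (v := u) (by rw [hcu]; exact hηα.trans_le h1)]
    linarith

end

end GeometricGraph

end TwoFace

/-! ### Winding angles: an edge on a cycle separates two faces. -/

namespace TwoFace

/-- A quotient `-r` with `r ≥ 0` would make `z` a convex combination of `u` and `v`. Hence the angle
under which an edge is seen is continuous in `z` off that edge. -/
theorem div_mem_slitPlane_of_notMem_segment {u v z : ℂ} (hz : z ∉ segment ℝ u v) :
    (v - z) / (u - z) ∈ Complex.slitPlane := by
  have hu : u - z ≠ 0 := fun h => hz (sub_eq_zero.1 h ▸ left_mem_segment ℝ u v)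
  rw [Complex.mem_slitPlane_iff]
  by_contra! h
  obtain ⟨hre, him⟩ := h
  set r := -((v - z) / (u - z)).re with hr
  have hr0 : 0 ≤ r := by linarith
  have heq : (v - z) / (u - z) = -(r : ℂ) := Complex.ext (by simp [hr]) (by simp [him])
  rw [div_eq_iff hu] at heq
  have h1 : (0 : ℝ) < 1 + r := by linarith
  have h1' : (1 + r : ℂ) ≠ 0 := by exact_mod_cast h1.ne'
  refine hz ⟨r / (1 + r), 1 / (1 + r), by positivity, by positivity, by field_simp; ring, ?_⟩
  rw [Complex.real_smul, Complex.real_smul]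
  push_cast
  field_simp
  linear_combination heq

/-- The sum of the angles under which the steps of a walk are seen from `z`. -/
def walkTurn {V : Type*} {H : SimpleGraph V} (pos : V → ℂ) (z : ℂ) :
    {u v : V} → H.Walk u v → ℝ
  | _, _, .nil => 0
  | u, _, .cons (v := x) _ p => ((pos x - z) / (pos u - z)).arg + walkTurn pos z p

theorem continuousAt_walkTurn {V : Type*} {H : SimpleGraph V} {pos : V → ℂ} {z : ℂ}
    (hz : ∀ x y, H.Adj x y → z ∉ segment ℝ (pos x) (pos y)) {u v : V} (p : H.Walk u v) :
    ContinuousAt (fun z => walkTurn pos z p) z := by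
  induction p with
  | nil => exact continuousAt_const
  | @cons u x v h p ih =>
    simp only [walkTurn]
    have hu : pos u - z ≠ 0 := fun h' =>
      hz u x h (sub_eq_zero.1 h' ▸ left_mem_segment ℝ (pos u) (pos x))
    refine ContinuousAt.add ?_ ih
    refine ContinuousAt.comp (g := Complex.arg) (f := fun z => (pos x - z) / (pos u - z))
      (Complex.continuousAt_arg (div_mem_slitPlane_of_notMem_segment (hz u x h))) ?_
    exact ContinuousAt.div (by fun_prop) (by fun_prop) hu

theorem exp_arg_div {u v : ℂ} (hu : u ≠ 0) (hv : v ≠ 0) :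
    Complex.exp ((v / u).arg * Complex.I) * (u / ‖u‖) = v / ‖v‖ := by
  have h := Complex.norm_mul_exp_arg_mul_I (v / u)
  have hu' : (‖u‖ : ℂ) ≠ 0 := by simpa using hu
  have hv' : (‖v‖ : ℂ) ≠ 0 := by simpa using hv
  rw [norm_div, Complex.ofReal_div] at h
  field_simp at h ⊢
  linear_combination h

theorem exp_walkTurn {V : Type*} {H : SimpleGraph V} {pos : V → ℂ} {z : ℂ}
    (hz : ∀ x y, H.Adj x y → pos y ≠ z) {u v : V} (hu : pos u ≠ z) (p : H.Walk u v) :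
    Complex.exp (walkTurn pos z p * Complex.I) * ((pos u - z) / ‖pos u - z‖) =
      (pos v - z) / ‖pos v - z‖ := by
  induction p with
  | nil => simp [walkTurn]
  | @cons u x v h p ih =>
    rw [← ih (hz u x h), ← exp_arg_div (sub_ne_zero.2 hu) (sub_ne_zero.2 (hz u x h))]
    simp only [walkTurn]
    push_cast
    rw [add_mul, Complex.exp_add]
    ring

/-- Along a closed walk the rotations of the unit direction from `z` compose to the identity, so the
total angle is a multiple of `2π`. -/
theorem exp_arg_add_walkTurn {V : Type*} {H : SimpleGraph V} {pos : V → ℂ} {z : ℂ}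
    (hz : ∀ x y, H.Adj x y → pos y ≠ z) {a b : V} (ha : pos a ≠ z) (hb : pos b ≠ z)
    (p : H.Walk b a) :
    Complex.exp ((((pos b - z) / (pos a - z)).arg + walkTurn pos z p : ℝ) * Complex.I) = 1 := by
  have ha := sub_ne_zero.2 ha
  have hne : (pos a - z) / ‖pos a - z‖ ≠ 0 := div_ne_zero ha (by simpa using ha)
  apply mul_right_cancel₀ hne
  have h := exp_walkTurn hz hb p
  rw [← exp_arg_div ha (sub_ne_zero.2 hb)] at h
  push_cast
  rw [add_mul, Complex.exp_add, one_mul]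
  linear_combination h

theorem edge_ratio_eq {ε : ℝ} :
    (1 - (1 / 2 + ε * Complex.I)) / (0 - (1 / 2 + ε * Complex.I)) =
      ⟨-(1 / 4 - ε ^ 2) / (1 / 4 + ε ^ 2), ε / (1 / 4 + ε ^ 2)⟩ := by
  have h : (1 / 4 + ε ^ 2 : ℝ) ≠ 0 := by positivity
  have hne : (0 - (1 / 2 + ε * Complex.I) : ℂ) ≠ 0 := fun h0 => by
    have := congrArg Complex.re h0
    norm_num at this
  rw [div_eq_iff hne]
  apply Complex.ext <;> simp <;> field_simp <;> ring

theorem tendsto_arg_edge_left :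
    Filter.Tendsto (fun ε : ℝ =>
      ((1 - (1 / 2 + ε * Complex.I)) / (0 - (1 / 2 + ε * Complex.I)) : ℂ).arg)
      (nhdsWithin 0 (Set.Ioi 0)) (nhds Real.pi) := by
  have h := Complex.tendsto_arg_nhdsWithin_im_nonneg_of_re_neg_of_im_zero (z := -1)
    (by simp) (by simp)
  refine h.comp (tendsto_nhdsWithin_iff.2 ⟨?_, ?_⟩)
  · have hc : ContinuousAt (fun ε : ℝ =>
        ((1 - (1 / 2 + ε * Complex.I)) / (0 - (1 / 2 + ε * Complex.I)) : ℂ)) 0 :=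
      ContinuousAt.div (by fun_prop) (by fun_prop) (by simp)
    have := hc.tendsto.mono_left (nhdsWithin_le_nhds (s := Set.Ioi 0))
    convert this using 2
    norm_num
  · filter_upwards [self_mem_nhdsWithin] with ε hε
    rw [edge_ratio_eq]
    have : 0 < ε := hε
    change 0 ≤ ε / (1 / 4 + ε ^ 2)
    positivity

theorem tendsto_arg_edge_right :
    Filter.Tendsto (fun ε : ℝ =>
      ((1 - (1 / 2 + (-ε : ℝ) * Complex.I)) / (0 - (1 / 2 + (-ε : ℝ) * Complex.I)) : ℂ).arg)
      (nhdsWithin 0 (Set.Ioi 0)) (nhds (-Real.pi)) := by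
  have h := Complex.tendsto_arg_nhdsWithin_im_neg_of_re_neg_of_im_zero (z := -1)
    (by simp) (by simp)
  refine h.comp (tendsto_nhdsWithin_iff.2 ⟨?_, ?_⟩)
  · have hc : ContinuousAt (fun ε : ℝ =>
        ((1 - (1 / 2 + (-ε : ℝ) * Complex.I)) / (0 - (1 / 2 + (-ε : ℝ) * Complex.I)) : ℂ)) 0 :=
      ContinuousAt.div (by fun_prop) (by fun_prop) (by simp)
    have := hc.tendsto.mono_left (nhdsWithin_le_nhds (s := Set.Ioi 0))
    convert this using 2
    norm_num
  · filter_upwards [self_mem_nhdsWithin] with ε hε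
    rw [edge_ratio_eq]
    have : 0 < ε := hε
    change -ε / (1 / 4 + (-ε) ^ 2) < 0
    have h1 : 0 < ε / (1 / 4 + ε ^ 2) := by positivity
    have h2 : -ε / (1 / 4 + (-ε) ^ 2) = -(ε / (1 / 4 + ε ^ 2)) := by ring
    linarith

namespace GeometricGraph

variable {V : Type*} {G : GeometricGraph V}

theorem arg_ratio_dartPoint {a b : V} (h : G.graph.Adj a b) (w : ℂ) :
    (G.pos b - G.dartPoint a b w) / (G.pos a - G.dartPoint a b w) = (1 - w) / (0 - w) := by
  have hne := pos_sub_ne_zero_of_adj h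
  rw [← mul_div_mul_right (1 - w) (0 - w) hne, dartPoint]
  congr 1 <;> ring

/-- An edge that lies on a cycle separates two different faces. -/
theorem Planar.leftFace_ne [Finite V] (hG : G.Planar) {a b : V} (hab : G.graph.Adj a b)
    (hr : (G.graph.deleteEdges {s(a, b)}).Reachable b a) :
    G.leftFace a b ≠ G.leftFace b a := by
  intro heq
  obtain ⟨p⟩ := hr
  set F := G.leftFace a b with hF
  have hface : G.IsFace F := hG.isFace_leftFace hab
  set g : ℂ → ℝ := fun z => walkTurn G.pos z p with hg
  -- The total angle, seen from `z`, of the closed walk made of the edge and the return path `p`.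
  set f : ℂ → ℝ := fun z => ((G.pos b - z) / (G.pos a - z)).arg + g z with hf
  have hadj : ∀ x y, (G.graph.deleteEdges {s(a, b)}).Adj x y →
      G.graph.Adj x y ∧ s(x, y) ≠ s(a, b) := fun x y h => by
    simpa using SimpleGraph.deleteEdges_adj.1 h
  have hcont : ContinuousOn f F := fun z hz => by
    have hzd := hface.subset_compl hz
    have hab' : z ∉ segment ℝ (G.pos a) (G.pos b) := fun h => hzd ⟨a, b, hab, h⟩
    have ha : G.pos a - z ≠ 0 := fun h' =>
      hab' (sub_eq_zero.1 h' ▸ left_mem_segment ℝ (G.pos a) (G.pos b))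
    refine ContinuousAt.continuousWithinAt (ContinuousAt.add ?_ ?_)
    · exact ContinuousAt.comp (g := Complex.arg) (f := fun z => (G.pos b - z) / (G.pos a - z))
        (Complex.continuousAt_arg (div_mem_slitPlane_of_notMem_segment hab'))
        (ContinuousAt.div (by fun_prop) (by fun_prop) ha)
    · exact continuousAt_walkTurn (fun x y h hm => hzd ⟨x, y, (hadj x y h).1, hm⟩) p
  have hexp : ∀ z ∈ F, Complex.exp (f z * Complex.I) = 1 := fun z hz => by
    have hne : ∀ x y, G.graph.Adj x y → G.pos y ≠ z := fun x y h hy =>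
      hface.subset_compl hz ⟨x, y, h, hy ▸ right_mem_segment _ _ _⟩
    exact exp_arg_add_walkTurn (fun x y h => hne x y (hadj x y h).1) (hne b a hab.symm)
      (hne a b hab) p
  have hmid : G.dartPoint a b (1 / 2) ∈ G.edgeSeg a b :=
    (dartPoint_mem_edgeSeg_iff hab.ne).2 (by norm_num)
  -- As `p` avoids the edge, only the first summand of `f` jumps at the midpoint, from `-π` on the
  -- right to `π` on the left.
  have hgmid : ContinuousAt g (G.dartPoint a b (1 / 2)) := by
    refine continuousAt_walkTurn (fun x y h hm => ?_) p
    obtain ⟨h1, h2⟩ := hadj x y h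
    obtain ⟨v, ⟨hv, -⟩, hvm⟩ := hG a b x y hab h1 h2.symm ⟨hmid, hm⟩
    have hne := pos_sub_ne_zero_of_adj hab
    rcases hv with rfl | rfl
    · have : (1 / 2 : ℂ) * (G.pos b - G.pos v) = 0 := by
        simp only [dartPoint] at hvm; linear_combination -hvm
      simp [hne] at this
    · have : (1 / 2 : ℂ) * (G.pos v - G.pos a) = 0 := by
        simp only [dartPoint] at hvm; linear_combination hvm
      simp [hne] at this
  have hgt : ∀ σ : ℝ, Filter.Tendsto
      (fun ε : ℝ => g (G.dartPoint a b (1 / 2 + (σ * ε : ℝ) * Complex.I)))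
      (nhdsWithin 0 (Set.Ioi 0)) (nhds (g (G.dartPoint a b (1 / 2)))) := fun σ => by
    have hc : Continuous (fun ε : ℝ => G.dartPoint a b (1 / 2 + (σ * ε : ℝ) * Complex.I)) :=
      (continuous_dartPoint a b).comp (by fun_prop)
    have := hc.tendsto 0
    simp only [mul_zero, Complex.ofReal_zero, zero_mul, add_zero] at this
    exact (hgmid.tendsto.comp this).mono_left nhdsWithin_le_nhds
  have hfl : Filter.Tendsto (fun ε : ℝ => f (G.dartPoint a b (1 / 2 + ε * Complex.I)))
      (nhdsWithin 0 (Set.Ioi 0)) (nhds (Real.pi + g (G.dartPoint a b (1 / 2)))) := by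
    simp only [hf, arg_ratio_dartPoint hab]
    exact tendsto_arg_edge_left.add (by simpa using hgt 1)
  have hfr : Filter.Tendsto (fun ε : ℝ => f (G.dartPoint a b (1 / 2 + (-ε : ℝ) * Complex.I)))
      (nhdsWithin 0 (Set.Ioi 0)) (nhds (-Real.pi + g (G.dartPoint a b (1 / 2)))) := by
    simp only [hf, arg_ratio_dartPoint hab]
    exact tendsto_arg_edge_right.add (by simpa using hgt (-1))
  have hpi := Real.pi_pos
  have hdiff := (hfl.sub hfr).eventually (lt_mem_nhds (show Real.pi < _ by linarith))
  have hleft := hG.leftOf_leftFace hab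
  have hright := hG.leftOf_leftFace hab.symm
  rw [← heq] at hright
  simp only [LeftOf, midpoint_add_eq_dartPoint] at hleft hright
  obtain ⟨ε, h1, h2, h3⟩ := (hdiff.and (hleft.and hright)).exists
  have h3' : G.dartPoint a b (1 / 2 + (-ε : ℝ) * Complex.I) ∈ F := by
    rw [dartPoint_symm]
    convert h3 using 2
    push_cast; ring
  have hpre : IsPreconnected F := by
    rw [hface.eq_pathComponentIn h2]
    exact (isPathConnected_pathComponentIn (hface.subset_compl h2)).isConnected.isPreconnected
  -- If both sides belonged to the connected face `F`, then `f` would also take a value that differs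
  -- by `π` from a multiple of `2π`.
  obtain ⟨z, hz, hfz⟩ := hpre.intermediate_value h3' h2 hcont
    (show f (G.dartPoint a b (1 / 2 + (-ε : ℝ) * Complex.I)) + Real.pi ∈ _ from
      ⟨by linarith, by linarith⟩)
  have h4 := hexp z hz
  rw [hfz] at h4
  push_cast at h4
  rw [add_mul, Complex.exp_add, Complex.exp_pi_mul_I] at h4
  have h5 := hexp _ h3'
  push_cast at h5
  rw [h5] at h4
  norm_num at h4

end GeometricGraph

end TwoFace

/-! ### The boundary of a face is a single closed walk. -/

namespace SimpleGraph

variable {V : Type*} {H : SimpleGraph V}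

/-- The end of a longest path is a leaf: by maximality its neighbors lie on the path, and by
acyclicity only the penultimate node can be one. -/
theorem IsAcyclic.exists_leaf [Finite V] (hH : H.IsAcyclic) {x y : V} (hxy : H.Adj x y) :
    ∃ a b, H.Adj a b ∧ ∀ c, H.Adj b c → c = a := by
  classical
  have := Fintype.ofFinite V
  let L : Set ℕ := {k | ∃ (u v : V) (p : H.Walk u v), p.IsPath ∧ p.length = k}
  have hL : L.Finite := (Set.finite_lt_nat (Fintype.card V)).subset (by
    rintro _ ⟨u, v, p, hp, rfl⟩
    exact hp.length_lt)
  have h1 : 1 ∈ L := ⟨x, y, hxy.toWalk, Walk.IsPath.of_adj hxy, by simp⟩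
  obtain ⟨k, ⟨u, b, p, hp, hk⟩, hmax⟩ := Set.exists_max_image L id hL ⟨1, h1⟩
  have hpos : 1 ≤ p.length := hk ▸ hmax 1 h1
  have hnil : ¬ p.Nil := fun h => by
    have := Walk.length_eq_zero_iff.2 h
    omega
  refine ⟨p.penultimate, b, p.adj_penultimate hnil, fun c hc => ?_⟩
  have hmem : c ∈ p.support := by
    by_contra hc'
    have := hmax _ ⟨u, c, p.concat hc, hp.concat hc' hc, rfl⟩
    simp only [id, Walk.length_concat] at this
    omega
  exact hH.eq_penultimate_of_adj_end hp hc hmem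

end SimpleGraph

namespace TwoFace

namespace GeometricGraph

variable {V : Type*} {G : GeometricGraph V}

open Classical in
/-- The successor of a dart along the boundary of the face on its left. -/
def faceNext (G : GeometricGraph V) (p : V × V) : V × V :=
  if h : ∃ c, G.graph.Adj p.1 p.2 ∧ G.IsNext Hand.R p.2 p.1 c then (p.2, h.choose) else p

theorem faceNext_of_isNext (hG : G.Planar) {a b c : V} (hab : G.graph.Adj a b)
    (h : G.IsNext Hand.R b a c) : G.faceNext (a, b) = (b, c) := by
  have hex : ∃ c, G.graph.Adj a b ∧ G.IsNext Hand.R b a c := ⟨c, hab, h⟩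
  rw [faceNext, dif_pos hex]
  exact Prod.ext rfl (hex.choose_spec.2.unique hG h)

theorem faceNext_of_not_adj {p : V × V} (hp : ¬ G.graph.Adj p.1 p.2) : G.faceNext p = p := by
  rw [faceNext, dif_neg]
  rintro ⟨c, h, -⟩
  exact hp h

/-- Two darts belong to the same boundary walk. -/
def SameWalk (G : GeometricGraph V) (x y : V × V) : Prop := ∃ k : ℕ, G.faceNext^[k] x = y

theorem SameWalk.trans {x y z : V × V} (h : G.SameWalk x y) (h' : G.SameWalk y z) :
    G.SameWalk x z := by
  obtain ⟨k, rfl⟩ := h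
  obtain ⟨l, rfl⟩ := h'
  exact ⟨l + k, Function.iterate_add_apply _ _ _ _⟩

/-- The geometric graph without the edge between `a` and `b`. -/
def deleteEdge (G : GeometricGraph V) (a b : V) : GeometricGraph V :=
  ⟨G.graph.deleteEdges {s(a, b)}, G.pos, G.pos_injective⟩

theorem deleteEdge_adj {a b x y : V} :
    (G.deleteEdge a b).graph.Adj x y ↔ G.graph.Adj x y ∧ (x, y) ≠ (a, b) ∧ (x, y) ≠ (b, a) := by
  simp only [deleteEdge, SimpleGraph.deleteEdges_adj, Set.mem_singleton_iff, Sym2.eq_iff, ne_eq,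
    Prod.mk.injEq]
  tauto

theorem Planar.deleteEdge (hG : G.Planar) (a b : V) : (G.deleteEdge a b).Planar :=
  fun x y x' y' h h' hne => hG x y x' y' (deleteEdge_adj.1 h).1 (deleteEdge_adj.1 h').1 hne

theorem drawing_deleteEdge_subset (a b : V) : (G.deleteEdge a b).drawing ⊆ G.drawing :=
  fun _ ⟨x, y, h, hz⟩ => ⟨x, y, (deleteEdge_adj.1 h).1, hz⟩

/-- A node whose edges rotate one to itself has degree one. -/
theorem IsNext.eq_of_adj (hG : G.Planar) {n b c : V} (h : G.IsNext Hand.R n b b)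
    (hc : G.graph.Adj n c) : c = b := by
  refine hG.eq_of_cwAngle_eq (u := G.pos b - G.pos n) hc h.1
    (le_antisymm ?_ (h.2 c hc))
  rw [cwAngle_self]
  exact cwAngle_le _ _

section

variable [Finite V]

theorem Planar.exists_faceNext (hG : G.Planar) {p : V × V} (hp : G.graph.Adj p.1 p.2) :
    ∃ c, G.IsNext Hand.R p.2 p.1 c ∧ G.faceNext p = (p.2, c) := by
  obtain ⟨c, hc⟩ := exists_isNext (G := G) hp.symm
  exact ⟨c, hc, faceNext_of_isNext hG hp hc⟩

theorem Planar.adj_faceNext (hG : G.Planar) {p : V × V} (hp : G.graph.Adj p.1 p.2) :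
    G.graph.Adj (G.faceNext p).1 (G.faceNext p).2 := by
  obtain ⟨c, hc, h⟩ := hG.exists_faceNext hp
  rw [h]
  exact hc.1

theorem Planar.adj_iterate_faceNext (hG : G.Planar) {p : V × V} (hp : G.graph.Adj p.1 p.2)
    (k : ℕ) : G.graph.Adj (G.faceNext^[k] p).1 (G.faceNext^[k] p).2 := by
  induction k with
  | zero => exact hp
  | succ k ih => rw [Function.iterate_succ_apply']; exact hG.adj_faceNext ih

theorem Planar.leftFace_faceNext (hG : G.Planar) {p : V × V} (hp : G.graph.Adj p.1 p.2) :
    G.leftFace (G.faceNext p).1 (G.faceNext p).2 = G.leftFace p.1 p.2 := by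
  obtain ⟨c, hc, h⟩ := hG.exists_faceNext hp
  rw [h]
  exact (hG.leftFace_eq_of_isNext hp.symm hc).symm

theorem Planar.leftFace_iterate_faceNext (hG : G.Planar) {p : V × V}
    (hp : G.graph.Adj p.1 p.2) (k : ℕ) :
    G.leftFace (G.faceNext^[k] p).1 (G.faceNext^[k] p).2 = G.leftFace p.1 p.2 := by
  induction k with
  | zero => rfl
  | succ k ih =>
    rw [Function.iterate_succ_apply', hG.leftFace_faceNext (hG.adj_iterate_faceNext hp k), ih]

/-- Pairs that are not darts are fixed, so this is an injective self-map of the finite set `V × V`;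
its orbits are cycles, which makes `SameWalk` symmetric. -/
theorem Planar.faceNext_injective (hG : G.Planar) : Function.Injective G.faceNext := by
  intro p q h
  by_cases hp : G.graph.Adj p.1 p.2 <;> by_cases hq : G.graph.Adj q.1 q.2
  · obtain ⟨c, hc, h1⟩ := hG.exists_faceNext hp
    obtain ⟨c', hc', h2⟩ := hG.exists_faceNext hq
    rw [h1, h2, Prod.mk.injEq] at h
    obtain ⟨h3, rfl⟩ := h
    rw [← h3] at hc' hq
    exact Prod.ext (hc.injective hG hp.symm hq.symm hc') h3
  · have := hG.adj_faceNext hp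
    rw [h, faceNext_of_not_adj hq] at this
    exact absurd this hq
  · have := hG.adj_faceNext hq
    rw [← h, faceNext_of_not_adj hp] at this
    exact absurd this hp
  · rwa [faceNext_of_not_adj hp, faceNext_of_not_adj hq] at h

theorem SameWalk.symm (hG : G.Planar) {x y : V × V} (h : G.SameWalk x y) : G.SameWalk y x := by
  obtain ⟨k, rfl⟩ := h
  obtain ⟨n, hn, hper⟩ := Function.mem_periodicPts.1 (hG.faceNext_injective.mem_periodicPts x)
  refine ⟨n * k - k, ?_⟩
  rw [← Function.iterate_add_apply, Nat.sub_add_cancel (Nat.le_mul_of_pos_left k hn), mul_comm]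
  exact hper.const_mul k

theorem Planar.leftFace_eq_of_sameWalk (hG : G.Planar) {x y : V × V}
    (hx : G.graph.Adj x.1 x.2) (h : G.SameWalk x y) :
    G.leftFace y.1 y.2 = G.leftFace x.1 x.2 := by
  obtain ⟨k, rfl⟩ := h
  exact hG.leftFace_iterate_faceNext hx k

theorem Planar.adj_of_sameWalk (hG : G.Planar) {x y : V × V}
    (hx : G.graph.Adj x.1 x.2) (h : G.SameWalk x y) : G.graph.Adj y.1 y.2 := by
  obtain ⟨k, rfl⟩ := h
  exact hG.adj_iterate_faceNext hx k

/-- An old face is path connected, avoids the smaller drawing, and meets the new face near the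
midpoint of the dart. Deleting an edge can therefore only merge faces. -/
theorem Planar.leftFace_subset_deleteEdge (hG : G.Planar) {a b x y : V}
    (h : (G.deleteEdge a b).graph.Adj x y) :
    G.leftFace x y ⊆ (G.deleteEdge a b).leftFace x y := by
  have h' := (deleteEdge_adj.1 h).1
  obtain ⟨ε, h1, h2⟩ := (Filter.Eventually.and (hG.leftOf_leftFace h')
    ((hG.deleteEdge a b).leftOf_leftFace h)).exists
  have hF := hG.isFace_leftFace h'
  refine ((hG.deleteEdge a b).isFace_leftFace h).subset_of_isPathConnected ?_ ?_ h2 h1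
  · rw [hF.eq_pathComponentIn h1]
    exact isPathConnected_pathComponentIn (hF.subset_compl h1)
  · exact hF.subset_compl.trans (Set.compl_subset_compl.2 (drawing_deleteEdge_subset a b))

theorem Planar.leftFace_deleteEdge_eq (hG : G.Planar) {a b : V} {x y : V × V}
    (hx : (G.deleteEdge a b).graph.Adj x.1 x.2) (hy : (G.deleteEdge a b).graph.Adj y.1 y.2)
    (h : G.leftFace x.1 x.2 = G.leftFace y.1 y.2) :
    (G.deleteEdge a b).leftFace x.1 x.2 = (G.deleteEdge a b).leftFace y.1 y.2 := by
  obtain ⟨ε, hε⟩ := (hG.leftOf_leftFace (deleteEdge_adj.1 hx).1).exists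
  exact ((hG.deleteEdge a b).isFace_leftFace hx).eq_of_mem
    ((hG.deleteEdge a b).isFace_leftFace hy) (hG.leftFace_subset_deleteEdge hx hε)
    (hG.leftFace_subset_deleteEdge hy (h ▸ hε))

theorem Planar.faceNext_deleteEdge (hG : G.Planar) {a b : V} {x : V × V}
    (hx : (G.deleteEdge a b).graph.Adj x.1 x.2) (h1 : G.faceNext x ≠ (a, b))
    (h2 : G.faceNext x ≠ (b, a)) : (G.deleteEdge a b).faceNext x = G.faceNext x := by
  obtain ⟨c, hc, h⟩ := hG.exists_faceNext (deleteEdge_adj.1 hx).1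
  rw [h] at h1 h2 ⊢
  exact faceNext_of_isNext (hG.deleteEdge a b) hx
    ⟨deleteEdge_adj.2 ⟨hc.1, h1, h2⟩, fun c' hc' => hc.2 c' (deleteEdge_adj.1 hc').1⟩

theorem Planar.iterate_faceNext_deleteEdge (hG : G.Planar) {a b : V} {x : V × V}
    (hx : G.graph.Adj x.1 x.2) (h1 : ¬ G.SameWalk x (a, b)) (h2 : ¬ G.SameWalk x (b, a)) (k : ℕ) :
    (G.deleteEdge a b).faceNext^[k] x = G.faceNext^[k] x := by
  induction k with
  | zero => rfl
  | succ k ih =>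
    rw [Function.iterate_succ_apply', Function.iterate_succ_apply', ih]
    refine hG.faceNext_deleteEdge (deleteEdge_adj.2 ⟨hG.adj_iterate_faceNext hx k,
      fun h => h1 ⟨k, h⟩, fun h => h2 ⟨k, h⟩⟩) (fun h => h1 ⟨k + 1, ?_⟩) (fun h => h2 ⟨k + 1, ?_⟩)
    all_goals rw [Function.iterate_succ_apply', h]

/-- Turning back at both ends means that both have degree one, so the edge is a whole component. -/
theorem Planar.dart_eq_of_faceNext_swap (hG : G.Planar)
    (hconn : ∀ x y x' y', G.graph.Adj x y → G.graph.Adj x' y' → G.graph.Reachable x x')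
    {u v : V} (huv : G.graph.Adj u v) (h1 : G.faceNext (u, v) = (v, u))
    (h2 : G.faceNext (v, u) = (u, v)) {x : V × V} (hx : G.graph.Adj x.1 x.2) :
    x = (u, v) ∨ x = (v, u) := by
  obtain ⟨c, hc, h⟩ := hG.exists_faceNext (p := (u, v)) huv
  obtain rfl : u = c := by rw [h1] at h; exact (Prod.mk.inj h).2
  obtain ⟨c, hc', h⟩ := hG.exists_faceNext (p := (v, u)) huv.symm
  obtain rfl : v = c := by rw [h2] at h; exact (Prod.mk.inj h).2
  have hu : ∀ y, G.graph.Adj u y → y = v := fun y hy => hc'.eq_of_adj hG hy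
  have hv : ∀ y, G.graph.Adj v y → y = u := fun y hy => hc.eq_of_adj hG hy
  have key : ∀ w, G.graph.Reachable u w → w = u ∨ w = v := by
    rintro w ⟨p⟩
    have : ∀ {s t : V} (p : G.graph.Walk s t), (s = u ∨ s = v) → (t = u ∨ t = v) := by
      intro s t p
      induction p with
      | nil => exact id
      | cons hadj p ih =>
        rintro (rfl | rfl)
        · exact ih (Or.inr (hu _ hadj))
        · exact ih (Or.inl (hv _ hadj))
    exact this p (Or.inl rfl)
  obtain ⟨x1, x2⟩ := x
  rcases key x1 (hconn _ _ _ _ huv hx) with rfl | rfl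
  · exact Or.inl (Prod.ext rfl (hu _ hx))
  · exact Or.inr (Prod.ext rfl (hv _ hx))

/-- The induction step for deleting one edge. Walks that avoid the edge survive unchanged, so only
walks through it need care; `hsep` joins its two darts when they have the same face. -/
theorem Planar.sameWalk_of_deleteEdge (hG : G.Planar)
    (hconn : ∀ x y x' y', G.graph.Adj x y → G.graph.Adj x' y' → G.graph.Reachable x x')
    {a b : V} (hab : G.graph.Adj a b)
    (hsep : G.leftFace a b = G.leftFace b a → G.SameWalk (a, b) (b, a))
    (IH : ∀ x y : V × V, (G.deleteEdge a b).graph.Adj x.1 x.2 →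
      (G.deleteEdge a b).graph.Adj y.1 y.2 →
      (G.deleteEdge a b).leftFace x.1 x.2 = (G.deleteEdge a b).leftFace y.1 y.2 →
      (G.deleteEdge a b).SameWalk x y)
    {x y : V × V} (hx : G.graph.Adj x.1 x.2) (hy : G.graph.Adj y.1 y.2)
    (h : G.leftFace x.1 x.2 = G.leftFace y.1 y.2) : G.SameWalk x y := by
  -- away from the walks through the edge nothing changes
  have away : ∀ {x y : V × V}, G.graph.Adj x.1 x.2 → G.graph.Adj y.1 y.2 →
      G.leftFace x.1 x.2 = G.leftFace y.1 y.2 → ¬ G.SameWalk x (a, b) → ¬ G.SameWalk x (b, a) →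
      y ≠ (a, b) → y ≠ (b, a) → G.SameWalk x y := by
    intro x y hx hy h h1 h2 h3 h4
    have hx' : (G.deleteEdge a b).graph.Adj x.1 x.2 :=
      deleteEdge_adj.2 ⟨hx, fun h => h1 ⟨0, h⟩, fun h => h2 ⟨0, h⟩⟩
    have hy' : (G.deleteEdge a b).graph.Adj y.1 y.2 := deleteEdge_adj.2 ⟨hy, h3, h4⟩
    obtain ⟨k, hk⟩ := IH x y hx' hy' (hG.leftFace_deleteEdge_eq hx' hy' h)
    exact ⟨k, by rw [← hk, hG.iterate_faceNext_deleteEdge hx h1 h2]⟩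
  -- a walk with the same face as a walk through the edge also passes through the edge
  have through : ∀ {x y : V × V}, G.graph.Adj x.1 x.2 → G.graph.Adj y.1 y.2 →
      G.leftFace x.1 x.2 = G.leftFace y.1 y.2 →
      (G.SameWalk x (a, b) ∨ G.SameWalk x (b, a)) →
      (G.SameWalk y (a, b) ∨ G.SameWalk y (b, a)) := by
    intro x y hx hy h hxe
    by_contra! hye
    -- Any other dart on the walk of `x` would be reached from `y` by `away`. So that walk consists
    -- of the two darts of the edge alone, and the edge is then all there is.
    have hsub : ∀ x', G.SameWalk x x' → x' = (a, b) ∨ x' = (b, a) := by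
      intro x' hxx'
      by_contra! hx'
      have hw := away hy (hG.adj_of_sameWalk hx hxx')
        (by rw [hG.leftFace_eq_of_sameWalk hx hxx', h]) hye.1 hye.2 hx'.1 hx'.2
      rcases hxe with hxe | hxe
      · exact hye.1 ((hw.trans (hxx'.symm hG)).trans hxe)
      · exact hye.2 ((hw.trans (hxx'.symm hG)).trans hxe)
    have hne : ∀ p : V × V, G.graph.Adj p.1 p.2 → G.faceNext p ≠ p := by
      intro p hp heq
      obtain ⟨c, hc, h⟩ := hG.exists_faceNext hp
      rw [h] at heq
      exact hp.ne (congrArg Prod.fst heq).symm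
    have hx1 := hsub _ ⟨1, rfl⟩
    have hx2 := hsub _ ⟨2, rfl⟩
    simp only [Function.iterate_succ, Function.iterate_zero, Function.comp, id] at hx1 hx2
    have hall : ∀ z : V × V, G.graph.Adj z.1 z.2 → z = (a, b) ∨ z = (b, a) := by
      intro z hz
      rcases hsub x ⟨0, rfl⟩ with rfl | rfl
      · have e1 := hx1.resolve_left (hne _ hab)
        rw [e1] at hx2
        exact hG.dart_eq_of_faceNext_swap hconn hab e1 (hx2.resolve_right (hne _ hab.symm)) hz
      · have e1 := hx1.resolve_right (hne _ hab.symm)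
        rw [e1] at hx2
        exact hG.dart_eq_of_faceNext_swap hconn hab (hx2.resolve_left (hne _ hab)) e1 hz
    rcases hall y hy with rfl | rfl
    · exact hye.1 ⟨0, rfl⟩
    · exact hye.2 ⟨0, rfl⟩
  by_cases hxe : G.SameWalk x (a, b) ∨ G.SameWalk x (b, a)
  · have hye := through hx hy h hxe
    have hsep' : ∀ {x y : V × V}, G.graph.Adj x.1 x.2 → G.graph.Adj y.1 y.2 →
        G.leftFace x.1 x.2 = G.leftFace y.1 y.2 → G.SameWalk x (a, b) → G.SameWalk y (b, a) →
        G.SameWalk (a, b) (b, a) := by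
      intro x y hx hy h h1 h2
      apply hsep
      have e1 := hG.leftFace_eq_of_sameWalk hx h1
      have e2 := hG.leftFace_eq_of_sameWalk hy h2
      simp only at e1 e2
      rw [e1, e2, h]
    rcases hxe with h1 | h1 <;> rcases hye with h2 | h2
    · exact h1.trans (h2.symm hG)
    · exact (h1.trans (hsep' hx hy h h1 h2)).trans (h2.symm hG)
    · exact (h1.trans ((hsep' hy hx h.symm h2 h1).symm hG)).trans (h2.symm hG)
    · exact h1.trans (h2.symm hG)
  · have hye : ¬ (G.SameWalk y (a, b) ∨ G.SameWalk y (b, a)) :=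
      fun hye => hxe (through hy hx h.symm hye)
    push Not at hxe hye
    exact away hx hy h hxe.1 hxe.2 (fun h => hye.1 ⟨0, h⟩) (fun h => hye.2 ⟨0, h⟩)

/-- If the edges of the graph are connected, then the boundary of a face is a single walk. -/
theorem Planar.sameWalk_of_leftFace_eq {G : GeometricGraph V} (hG : G.Planar)
    (hconn : ∀ x y x' y', G.graph.Adj x y → G.graph.Adj x' y' → G.graph.Reachable x x')
    {x y : V × V} (hx : G.graph.Adj x.1 x.2) (hy : G.graph.Adj y.1 y.2)
    (h : G.leftFace x.1 x.2 = G.leftFace y.1 y.2) : G.SameWalk x y := by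
  -- Connectedness is required only between nodes that have edges, because deleting a leaf edge
  -- isolates the leaf.
  induction hH : G.graph using WellFoundedLT.induction generalizing G x y with
  | ind H ihH =>
  subst hH
  have IH : ∀ {a b : V}, G.graph.Adj a b → (∀ x y x' y', (G.deleteEdge a b).graph.Adj x y →
      (G.deleteEdge a b).graph.Adj x' y' → (G.deleteEdge a b).graph.Reachable x x') →
      ∀ x y : V × V, (G.deleteEdge a b).graph.Adj x.1 x.2 →
      (G.deleteEdge a b).graph.Adj y.1 y.2 →
      (G.deleteEdge a b).leftFace x.1 x.2 = (G.deleteEdge a b).leftFace y.1 y.2 →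
      (G.deleteEdge a b).SameWalk x y := by
    intro a b hab hc x y hx hy h
    refine ihH (G.deleteEdge a b).graph ?_ (hG.deleteEdge a b) hc hx hy h rfl
    refine lt_of_le_of_ne (SimpleGraph.deleteEdges_le _) fun heq => ?_
    have : (G.deleteEdge a b).graph.Adj a b := heq ▸ hab
    exact (deleteEdge_adj.1 this).2.1 rfl
  by_cases hac : G.graph.IsAcyclic
  · obtain ⟨a, b, hab, hleaf⟩ := hac.exists_leaf hx
    refine hG.sameWalk_of_deleteEdge hconn hab (fun _ => ⟨1, ?_⟩) (IH hab ?_) hx hy h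
    · obtain ⟨c, hc, h⟩ := hG.exists_faceNext (p := (a, b)) hab
      rw [Function.iterate_one, h, hleaf c hc.1]
    · classical
      have hnb : ∀ {u v}, (G.deleteEdge a b).graph.Adj u v → u ≠ b := by
        rintro u v huv rfl
        obtain ⟨h1, h2, h3⟩ := deleteEdge_adj.1 huv
        exact h3 (by rw [hleaf v h1])
      -- Retracting the leaf `b` to `a` maps walks to walks without the leaf edge.
      have key : ∀ {u v : V} (p : G.graph.Walk u v), (G.deleteEdge a b).graph.Reachable
          (if u = b then a else u) (if v = b then a else v) := by
        intro u v p
        induction p with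
        | nil => exact SimpleGraph.Reachable.refl _
        | @cons u w v huw p ih =>
          refine SimpleGraph.Reachable.trans ?_ ih
          by_cases hu : u = b
          · subst hu
            obtain rfl := hleaf w huw
            rw [if_pos rfl, if_neg huw.ne']
          · by_cases hw : w = b
            · subst hw
              obtain rfl := hleaf u huw.symm
              rw [if_pos rfl, if_neg huw.ne]
            · rw [if_neg hu, if_neg hw]
              refine SimpleGraph.Adj.reachable (deleteEdge_adj.2 ⟨huw, ?_, ?_⟩)
              · exact fun h => hw (Prod.mk.inj h).2
              · exact fun h => hu (Prod.mk.inj h).1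
      intro u v u' v' huv huv'
      obtain ⟨p⟩ := hconn u v u' v' (deleteEdge_adj.1 huv).1 (deleteEdge_adj.1 huv').1
      have := key p
      rwa [if_neg (hnb huv), if_neg (hnb huv')] at this
  · rw [SimpleGraph.isAcyclic_iff_forall_adj_isBridge] at hac
    push Not at hac
    obtain ⟨a, b, hab, hbr⟩ := hac
    rw [SimpleGraph.isBridge_iff, not_not] at hbr
    -- The edge is not a bridge, so it lies on a cycle and its two faces differ; the separation
    -- hypothesis is vacuous.
    refine hG.sameWalk_of_deleteEdge hconn hab
      (fun heq => absurd heq (hG.leftFace_ne hab hbr.symm)) (IH hab ?_) hx hy h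
    have hbr' : (G.deleteEdge a b).graph.Reachable a b := hbr
    have key : ∀ {u v : V} (p : G.graph.Walk u v), (G.deleteEdge a b).graph.Reachable u v := by
      intro u v p
      induction p with
      | nil => exact SimpleGraph.Reachable.refl _
      | @cons u w v huw p ih =>
        refine SimpleGraph.Reachable.trans ?_ ih
        by_cases h1 : (u, w) = (a, b)
        · obtain ⟨rfl, rfl⟩ := Prod.mk.inj h1
          exact hbr'
        by_cases h2 : (u, w) = (b, a)
        · obtain ⟨rfl, rfl⟩ := Prod.mk.inj h2
          exact hbr'.symm
        exact SimpleGraph.Adj.reachable (deleteEdge_adj.2 ⟨huw, h1, h2⟩)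
    intro u v u' v' huv huv'
    obtain ⟨p⟩ := hconn u v u' v' (deleteEdge_adj.1 huv).1 (deleteEdge_adj.1 huv').1
    exact key p

end

end GeometricGraph

end TwoFace

/-! ### Single actions and their effect on the queues. -/

namespace TwoFace

theorem Hand.opp_opp (h : Hand) : h.opp.opp = h := by cases h <;> rfl

namespace GeometricGraph

variable {V : Type*} {G : GeometricGraph V}

/-- The dart along which, or against which, a packet of `n` is to be sent. -/
def packetDart (n : V) (p : Packet V) : V × V :=
  match p.token.hand with
  | Hand.R => (n, p.dest)
  | Hand.L => (p.dest, n)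

/-- The packet is to be sent along an edge that has the face of the token on the side that
corresponds to the traversal rule. -/
def ValidPacket (G : GeometricGraph V) (n : V) (p : Packet V) : Prop :=
  G.graph.Adj n p.dest ∧ p.token.face = G.leftFace (packetDart n p).1 (packetDart n p).2

theorem validPacket_R {n b : V} {F : Set ℂ} :
    G.ValidPacket n ⟨⟨Hand.R, F⟩, b⟩ ↔ G.graph.Adj n b ∧ F = G.leftFace n b := Iff.rfl

theorem validPacket_L {n b : V} {F : Set ℂ} :
    G.ValidPacket n ⟨⟨Hand.L, F⟩, b⟩ ↔ G.graph.Adj n b ∧ F = G.leftFace b n := Iff.rfl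

theorem mem_tokenPair {F : Set ℂ} {p : V × V} {q : Packet V} :
    q ∈ tokenPair F p ↔ q = ⟨⟨Hand.L, F⟩, p.1⟩ ∨ q = ⟨⟨Hand.R, F⟩, p.2⟩ := by
  simp [tokenPair]

/-- The packets that `n` queues when it retransmits the token `T` to `x` and starts traversals of
the faces in `S`. -/
def forwarded (T : Token) (x : V) (S : Finset (Set ℂ)) (κ : Set ℂ → V × V) :
    Multiset (Packet V) :=
  ⟨T, x⟩ ::ₘ ∑ F' ∈ S, tokenPair F' (κ F')

theorem mem_forwarded {T : Token} {x : V} {S : Finset (Set ℂ)} {κ : Set ℂ → V × V}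
    {q : Packet V} : q ∈ forwarded T x S κ ↔
      q = ⟨T, x⟩ ∨ ∃ F' ∈ S, q = ⟨⟨Hand.L, F'⟩, (κ F').1⟩ ∨ q = ⟨⟨Hand.R, F'⟩, (κ F').2⟩ := by
  simp [forwarded, Multiset.mem_sum, mem_tokenPair]

/-- `n` receives `T` from `m` and then queues the packets in `new`. -/
def Forwards (G : GeometricGraph V) (s d : V) (resp : V → V → Prop) (m n : V) (T : Token)
    (new : Multiset (Packet V)) : Prop :=
  n ≠ d ∧ ∃ (x : V) (S : Finset (Set ℂ)) (κ : Set ℂ → V × V),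
    G.IsNext T.hand n m x ∧
    (∀ F', F' ∈ S ↔ F' ≠ T.face ∧ G.IsEntryPoint s d resp n T.face ∧
      G.IsEntryPoint s d resp n F') ∧
    (∀ F' ∈ S, G.IsCorner n (κ F').1 (κ F').2 F') ∧ new = forwarded T x S κ

open Classical in
/-- An action without delivery: two tokens meet, or a token is forwarded. -/
theorem Step.cases_of_delivered_eq_zero {s d : V} {resp : V → V → Prop} {c c' : Config V}
    (h : G.Step s d resp c c') (hdel : c'.delivered = 0)
    (hne : ∀ n, ∀ p ∈ c.sq n, p.dest ≠ n) :
    ∃ (m : V) (p : Packet V), p ∈ c.sq m ∧ c'.sq m = (c.sq m).erase p ∧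
      (∀ n, n ≠ m → n ≠ p.dest → c'.sq n = c.sq n) ∧
      (((⟨⟨p.token.hand.opp, p.token.face⟩, m⟩ : Packet V) ∈ c.sq p.dest ∧
        c'.sq p.dest = (c.sq p.dest).erase ⟨⟨p.token.hand.opp, p.token.face⟩, m⟩) ∨
      ∃ new, G.Forwards s d resp m p.dest p.token new ∧
        c'.sq p.dest = new + c.sq p.dest) := by
  obtain ⟨m, p, hp, q', del, hrec, rfl⟩ := h
  have hpm := hne m p hp
  simp only [Function.update_of_ne hpm] at hrec
  refine ⟨m, p, hp, ?_, ?_, ?_⟩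
  · simp [Function.update_of_ne hpm.symm]
  · intro n h1 h2
    simp [Function.update_of_ne h1, Function.update_of_ne h2]
  · simp only [Function.update_self]
    cases hrec with
    | meet hmeet => exact Or.inl ⟨hmeet, rfl⟩
    | deliver hmeet hd x hx => simp at hdel
    | forward hmeet hd x hx S hS κ hκ =>
      refine Or.inr ⟨_, ⟨hd, x, S, κ, hx, hS, hκ, rfl⟩, ?_⟩
      rw [forwarded, Multiset.cons_add, add_comm]

/-- Transmissions and meetings only remove packets, so a new packet stems from forwarding. Its whole
batch is queued at once, which later yields the partner of a token and the other traversals started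
with it. -/
theorem Step.exists_forwards_of_new {s d : V} {resp : V → V → Prop} {c c' : Config V}
    (h : G.Step s d resp c c') (hdel : c'.delivered = 0)
    (hne : ∀ n, ∀ p ∈ c.sq n, p.dest ≠ n) {n : V} {q : Packet V} (hq : q ∈ c'.sq n)
    (hq' : q ∉ c.sq n) :
    ∃ (m : V) (T : Token) (new : Multiset (Packet V)), (⟨T, n⟩ : Packet V) ∈ c.sq m ∧
      G.Forwards s d resp m n T new ∧ q ∈ new ∧ ∀ r ∈ new, r ∈ c'.sq n := by
  classical
  obtain ⟨m, ⟨T, b⟩, hp, h1, h2, h3⟩ := h.cases_of_delivered_eq_zero hdel hne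
  by_cases hnm : n = m
  · subst hnm
    rw [h1] at hq
    exact absurd (Multiset.mem_of_mem_erase hq) hq'
  by_cases hnp : n = b
  · subst hnp
    rcases h3 with ⟨-, h3⟩ | ⟨new, hnew, h3⟩
    · rw [h3] at hq
      exact absurd (Multiset.mem_of_mem_erase hq) hq'
    · rw [h3] at hq ⊢
      exact ⟨m, T, new, hp, hnew, (Multiset.mem_add.1 hq).resolve_right hq',
        fun r hr => Multiset.mem_add.2 (Or.inl hr)⟩
  · rw [h2 n hnm hnp] at hq
    exact absurd hq hq'

open Classical in
/-- A packet disappears only if its token meets the matching one or moves on. -/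
theorem Step.meets_or_moves_of_count_lt {s d : V} {resp : V → V → Prop} {c c' : Config V}
    (h : G.Step s d resp c c') (hdel : c'.delivered = 0)
    (hne : ∀ n, ∀ p ∈ c.sq n, p.dest ≠ n) {n : V} {q : Packet V}
    (hq : (c'.sq n).count q < (c.sq n).count q) :
    (⟨⟨q.token.hand.opp, q.token.face⟩, n⟩ : Packet V) ∈ c.sq q.dest ∨
      ∃ x, G.IsNext q.token.hand q.dest n x ∧ (⟨q.token, x⟩ : Packet V) ∈ c'.sq q.dest := by
  obtain ⟨m, p, hp, h1, h2, h3⟩ := h.cases_of_delivered_eq_zero hdel hne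
  by_cases hnm : n = m
  · subst hnm
    obtain rfl : q = p := by
      by_contra hqp
      rw [h1, Multiset.count_erase_of_ne hqp] at hq
      exact lt_irrefl _ hq
    rcases h3 with ⟨h3, -⟩ | ⟨new, ⟨-, x, S, κ, hx, -, -, rfl⟩, h3⟩
    · exact Or.inl h3
    · refine Or.inr ⟨x, hx, ?_⟩
      rw [h3]
      exact Multiset.mem_add.2 (Or.inl (mem_forwarded.2 (Or.inl rfl)))
  by_cases hnp : n = p.dest
  · subst hnp
    rcases h3 with ⟨-, h3⟩ | ⟨new, -, h3⟩
    · obtain rfl : q = ⟨⟨p.token.hand.opp, p.token.face⟩, m⟩ := by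
        by_contra hqp
        rw [h3, Multiset.count_erase_of_ne hqp] at hq
        exact lt_irrefl _ hq
      left
      simpa only [Hand.opp_opp] using hp
    · rw [h3, Multiset.count_add] at hq
      omega
  · rw [h2 n hnm hnp] at hq
    exact absurd hq (lt_irrefl _)

section Validity

variable [Finite V]

theorem IsCorner.leftFace_eq (hG : G.Planar) {n b c : V} {F : Set ℂ} (hF : G.IsFace F)
    (h : G.IsCorner n b c F) : F = G.leftFace n c ∧ F = G.leftFace b n := by
  obtain ⟨h1, h2, h3⟩ := h
  have h4 := (hG.leftOf_iff_eq_leftFace h2.1 hF).1 h3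
  exact ⟨h4, h4.trans (hG.leftFace_eq_of_isNext h1 h2).symm⟩

theorem IsCorner.validPacket (hG : G.Planar) {n : V} {κ : V × V} {F : Set ℂ} (hF : G.IsFace F)
    (h : G.IsCorner n κ.1 κ.2 F) {q : Packet V} (hq : q ∈ tokenPair F κ) : G.ValidPacket n q := by
  obtain ⟨h1, h2⟩ := h.leftFace_eq hG hF
  rcases mem_tokenPair.1 hq with rfl | rfl
  · exact validPacket_L.2 ⟨h.1, h2⟩
  · exact validPacket_R.2 ⟨h.2.1.1, h1⟩

theorem Forwards.validPacket (hG : G.Planar) {s d m n : V} {resp : V → V → Prop} {T : Token}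
    {new : Multiset (Packet V)} (h : G.Forwards s d resp m n T new)
    (hT : G.ValidPacket m ⟨T, n⟩) {q : Packet V} (hq : q ∈ new) : G.ValidPacket n q := by
  obtain ⟨-, x, S, κ, hx, hS, hκ, rfl⟩ := h
  rcases mem_forwarded.1 hq with rfl | ⟨F', hF', hq⟩
  · obtain ⟨hand, F⟩ := T
    cases hand with
    | R =>
      obtain ⟨h1, h2⟩ := validPacket_R.1 hT
      exact validPacket_R.2 ⟨hx.1, h2.trans (hG.leftFace_eq_of_isNext h1.symm hx)⟩
    | L =>
      obtain ⟨h1, h2⟩ := validPacket_L.1 hT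
      exact validPacket_L.2 ⟨hx.1,
        h2.trans (hG.leftFace_eq_of_isNext hx.1 (hx.toRight h1.symm)).symm⟩
  · exact (hκ F' hF').validPacket hG ((hS F').1 hF').2.2.1 (mem_tokenPair.2 hq)

end Validity

/-! ### Runs without delivery: every traversal completes its face. -/

/-- The setting of a computation in which nothing is delivered. -/
structure Undelivered (G : GeometricGraph V) (s d : V) (resp : V → V → Prop)
    (c : ℕ → Config V) : Prop where
  planar : G.Planar
  connected : G.graph.Connected
  ne : s ≠ d
  computation : G.IsComputation s d resp c
  delivered_eq_zero : ∀ t, (c t).delivered = 0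

/-- A packet for the face `F` is at some time in the send queue of `n`. -/
def SeenAt (c : ℕ → Config V) (n : V) (F : Set ℂ) : Prop :=
  ∃ (t : ℕ) (p : Packet V), p ∈ (c t).sq n ∧ p.token.face = F

/-- At time `t` an `R` token is to be sent along the dart `e`. -/
def HasR (G : GeometricGraph V) (c : ℕ → Config V) (t : ℕ) (e : V × V) : Prop :=
  (⟨⟨Hand.R, G.leftFace e.1 e.2⟩, e.2⟩ : Packet V) ∈ (c t).sq e.1

/-- At time `t` an `L` token is to be sent against the dart `e`. -/
def HasL (G : GeometricGraph V) (c : ℕ → Config V) (t : ℕ) (e : V × V) : Prop :=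
  (⟨⟨Hand.L, G.leftFace e.1 e.2⟩, e.1⟩ : Packet V) ∈ (c t).sq e.2

/-- Up to time `t` a token has appeared in the corner before the dart `e`. -/
def Visited (G : GeometricGraph V) (c : ℕ → Config V) (t : ℕ) (e : V × V) : Prop :=
  ∃ t' ≤ t, G.HasR c t' e ∨ ∃ e', G.HasL c t' e' ∧ G.faceNext e' = e

theorem Visited.mono {c : ℕ → Config V} {t t' : ℕ} (htt' : t ≤ t') {e : V × V}
    (h : G.Visited c t e) : G.Visited c t' e := by
  obtain ⟨u, hu, h⟩ := h
  exact ⟨u, hu.trans htt', h⟩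

theorem HasR.visited {c : ℕ → Config V} {t : ℕ} {e : V × V} (h : G.HasR c t e) :
    G.Visited c t e := ⟨t, le_rfl, Or.inl h⟩

theorem HasL.visited {c : ℕ → Config V} {t : ℕ} {e : V × V} (h : G.HasL c t e) :
    G.Visited c t (G.faceNext e) := ⟨t, le_rfl, Or.inr ⟨e, h, rfl⟩⟩

namespace Undelivered

variable {s d : V} {resp : V → V → Prop} {c : ℕ → Config V}

/-- At the start there is one pair of packets, in one corner at `s`. -/
theorem initial (h : G.Undelivered s d resp c) :
    ∃ (F : Set ℂ) (κ : V × V), G.IsFace F ∧ G.FaceMeets s d F ∧ G.IsCorner s κ.1 κ.2 F ∧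
      (c 0).sq s = tokenPair F κ ∧ ∀ n, n ≠ s → (c 0).sq n = 0 := by
  obtain ⟨F, κ, h1, -, h3, h4, h5⟩ := h.computation.1
  refine ⟨F, κ, h1, h3, h4, by simp [h5], fun n hn => by simp [h5, hn]⟩

theorem step_or_eq (h : G.Undelivered s d resp c) (t : ℕ) :
    G.Step s d resp (c t) (c (t + 1)) ∨ c (t + 1) = c t := h.computation.2.1 t

variable [Finite V]

theorem validPacket (h : G.Undelivered s d resp c) (t : ℕ) :
    ∀ n, ∀ p ∈ (c t).sq n, G.ValidPacket n p := by
  induction t with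
  | zero =>
    intro n p hp
    obtain ⟨F, κ, hF, -, hκ, h1, h2⟩ := h.initial
    by_cases hn : n = s
    · subst hn
      rw [h1] at hp
      exact hκ.validPacket h.planar hF hp
    · simp [h2 n hn] at hp
  | succ t ih =>
    intro n p hp
    rcases h.step_or_eq t with hst | heq
    · by_cases hp' : p ∈ (c t).sq n
      · exact ih n p hp'
      · obtain ⟨m, T, new, hT, hf, hmem, -⟩ := hst.exists_forwards_of_new
          (h.delivered_eq_zero _) (fun n p hp => (ih n p hp).1.ne') hp hp'
        exact hf.validPacket h.planar (ih m _ hT) hmem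
    · exact ih n p (heq ▸ hp)

theorem dest_ne (h : G.Undelivered s d resp c) (t : ℕ) :
    ∀ n, ∀ p ∈ (c t).sq n, p.dest ≠ n :=
  fun n p hp => (h.validPacket t n p hp).1.ne'

theorem exists_forwards_of_new (h : G.Undelivered s d resp c) {t : ℕ} {n : V} {q : Packet V}
    (hq : q ∈ (c (t + 1)).sq n) (hq' : q ∉ (c t).sq n) :
    ∃ (m : V) (T : Token) (new : Multiset (Packet V)), (⟨T, n⟩ : Packet V) ∈ (c t).sq m ∧
      G.Forwards s d resp m n T new ∧ q ∈ new ∧ ∀ r ∈ new, r ∈ (c (t + 1)).sq n := by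
  rcases h.step_or_eq t with hst | heq
  · exact hst.exists_forwards_of_new (h.delivered_eq_zero _) (h.dest_ne t) hq hq'
  · exact absurd (heq ▸ hq) hq'

theorem hasR_of_mem (h : G.Undelivered s d resp c) {t : ℕ} {n b : V} {F : Set ℂ}
    (hp : (⟨⟨Hand.R, F⟩, b⟩ : Packet V) ∈ (c t).sq n) : G.HasR c t (n, b) := by
  have := (validPacket_R.1 (h.validPacket t n _ hp)).2
  simpa only [HasR, ← this] using hp

theorem hasL_of_mem (h : G.Undelivered s d resp c) {t : ℕ} {n b : V} {F : Set ℂ}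
    (hp : (⟨⟨Hand.L, F⟩, b⟩ : Packet V) ∈ (c t).sq n) : G.HasL c t (b, n) := by
  have := (validPacket_L.1 (h.validPacket t n _ hp)).2
  simpa only [HasL, ← this] using hp

theorem adj_of_hasR (h : G.Undelivered s d resp c) {t : ℕ} {e : V × V} (he : G.HasR c t e) :
    G.graph.Adj e.1 e.2 := (h.validPacket t _ _ he).1

theorem adj_of_hasL (h : G.Undelivered s d resp c) {t : ℕ} {e : V × V} (he : G.HasL c t e) :
    G.graph.Adj e.1 e.2 := (h.validPacket t _ _ he).1.symm

theorem adj_of_visited (h : G.Undelivered s d resp c) {t : ℕ} {e : V × V}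
    (he : G.Visited c t e) : G.graph.Adj e.1 e.2 := by
  obtain ⟨t', -, he | ⟨e', he, rfl⟩⟩ := he
  · exact h.adj_of_hasR he
  · exact h.planar.adj_faceNext (h.adj_of_hasL he)

open Classical in
-- The `R` token either moves on to the next dart or meets an `L` token queued against `e`, and that
-- `L` token sits in the next corner.
theorem visited_faceNext_of_count_lt (h : G.Undelivered s d resp c) {t : ℕ} {e : V × V}
    (he : G.graph.Adj e.1 e.2)
    (hlt : ((c (t + 1)).sq e.1).count ⟨⟨Hand.R, G.leftFace e.1 e.2⟩, e.2⟩ <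
      ((c t).sq e.1).count ⟨⟨Hand.R, G.leftFace e.1 e.2⟩, e.2⟩) :
    G.Visited c (t + 1) (G.faceNext e) := by
  rcases h.step_or_eq t with hst | heq
  · rcases hst.meets_or_moves_of_count_lt (h.delivered_eq_zero _) (h.dest_ne t) hlt with
      hm | ⟨x, hx, hm⟩
    · exact (HasL.visited (h.hasL_of_mem (F := G.leftFace e.1 e.2) hm)).mono (Nat.le_succ t)
    · have := (h.hasR_of_mem hm).visited
      rwa [← faceNext_of_isNext h.planar he hx] at this
  · rw [heq] at hlt
    exact absurd hlt (lt_irrefl _)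

/-- Behind the last visited corner of a face there is an `R` token. -/
theorem hasR_of_visited (h : G.Undelivered s d resp c) (t : ℕ) {e : V × V}
    (he : G.Visited c t e) (hne : ¬ G.Visited c t (G.faceNext e)) : G.HasR c t e := by
  classical
  induction t with
  | zero =>
    obtain ⟨t', ht', he | ⟨e', he, rfl⟩⟩ := he
    · obtain rfl := Nat.le_zero.1 ht'
      exact he
    · obtain rfl := Nat.le_zero.1 ht'
      obtain ⟨F, κ, hF, -, hκ, h1, h2⟩ := h.initial
      have hadj := h.adj_of_hasL he
      obtain ⟨a, n⟩ := e'
      rw [HasL] at he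
      by_cases hn : n = s
      · subst hn
        simp only [h1, mem_tokenPair, Packet.mk.injEq, Token.mk.injEq, reduceCtorEq, false_and,
          or_false] at he
        obtain ⟨-, rfl⟩ := he
        rw [faceNext_of_isNext h.planar hadj hκ.2.1]
        apply h.hasR_of_mem (F := F)
        rw [h1]
        exact mem_tokenPair.2 (Or.inr rfl)
      · simp [h2 n hn] at he
  | succ t ih =>
    have hne' : ¬ G.Visited c t (G.faceNext e) := fun hv => hne (hv.mono (Nat.le_succ t))
    have hadj := h.adj_of_visited he
    by_contra hR
    by_cases hvis : G.Visited c t e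
    · have hRt := ih hvis hne'
      refine hne (h.visited_faceNext_of_count_lt hadj ?_)
      rw [Multiset.count_eq_zero.2 hR]
      exact Multiset.count_pos.2 hRt
    · obtain ⟨t', ht', he'⟩ := he
      obtain rfl : t' = t + 1 := by
        by_contra hlt
        exact hvis ⟨t', by omega, he'⟩
      rcases he' with he' | ⟨⟨a, n⟩, he', rfl⟩
      · exact hR he'
      · have hold : ¬ G.HasL c t (a, n) := fun hL => hvis hL.visited
        have hadj' := h.adj_of_hasL he'
        obtain ⟨m, T, new, hT, ⟨-, x, S, κ, hx, hS, hκ, rfl⟩, hmem, hsub⟩ :=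
          h.exists_forwards_of_new he' hold
        -- A forwarded `L` token comes from the successor corner, which was thus visited before; a
        -- freshly started one has its `R` partner in the same corner.
        rcases mem_forwarded.1 hmem with heq | ⟨F', hF', heq | heq⟩
        · obtain ⟨rfl, rfl⟩ := Packet.mk.inj heq
          have hmn := (h.validPacket t _ _ hT).1
          have hL := h.hasL_of_mem hT
          have hnext := faceNext_of_isNext h.planar hadj' (hx.toRight hmn.symm)
          rw [← hnext] at hL
          exact hne' hL.visited
        · simp only [Packet.mk.injEq, Token.mk.injEq, true_and] at heq
          obtain ⟨-, rfl⟩ := heq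
          rw [faceNext_of_isNext h.planar hadj' (hκ F' hF').2.1] at hR
          exact hR (h.hasR_of_mem (hsub _ (mem_forwarded.2 (Or.inr ⟨F', hF', Or.inr rfl⟩))))
        · simp at heq

theorem exists_visited_faceNext (h : G.Undelivered s d resp c) {t : ℕ} {e : V × V}
    (he : G.Visited c t e) : ∃ t', G.Visited c t' (G.faceNext e) := by
  by_contra! hne
  obtain ⟨t', ht', hlt⟩ := h.computation.2.2 t _ _ (h.hasR_of_visited t he (hne t))
  exact hne _ (h.visited_faceNext_of_count_lt (h.adj_of_visited he) hlt)

theorem exists_visited_of_sameWalk (h : G.Undelivered s d resp c) {t : ℕ} {e e' : V × V}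
    (he : G.Visited c t e) (hw : G.SameWalk e e') : ∃ t', G.Visited c t' e' := by
  obtain ⟨k, rfl⟩ := hw
  induction k with
  | zero => exact ⟨t, he⟩
  | succ k ih =>
    obtain ⟨t', ht'⟩ := ih
    rw [Function.iterate_succ_apply']
    exact h.exists_visited_faceNext ht'

theorem seenAt_of_visited (h : G.Undelivered s d resp c) {t : ℕ} {e : V × V}
    (he : G.Visited c t e) : SeenAt c e.1 (G.leftFace e.1 e.2) := by
  obtain ⟨t', -, he | ⟨e', he, rfl⟩⟩ := he
  · exact ⟨t', _, he, rfl⟩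
  · have hadj := h.adj_of_hasL he
    rw [h.planar.leftFace_faceNext hadj]
    obtain ⟨x, -, hx⟩ := h.planar.exists_faceNext hadj
    rw [hx]
    exact ⟨t', _, he, rfl⟩

theorem exists_visited_of_seenAt (h : G.Undelivered s d resp c) {n : V} {F : Set ℂ}
    (hF : SeenAt c n F) :
    ∃ (t : ℕ) (e : V × V), G.Visited c t e ∧ G.leftFace e.1 e.2 = F := by
  obtain ⟨t, ⟨⟨hand, F⟩, b⟩, hp, rfl⟩ := hF
  have hv := h.validPacket t n _ hp
  cases hand with
  | R => exact ⟨t, (n, b), (h.hasR_of_mem hp).visited, hv.2.symm⟩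
  | L =>
    refine ⟨t, _, (h.hasL_of_mem hp).visited, ?_⟩
    rw [h.planar.leftFace_faceNext hv.1.symm]
    exact hv.2.symm

theorem isFace_of_seenAt (h : G.Undelivered s d resp c) {n : V} {F : Set ℂ}
    (hF : SeenAt c n F) : G.IsFace F := by
  obtain ⟨t, e, he, rfl⟩ := h.exists_visited_of_seenAt hF
  exact h.planar.isFace_leftFace (h.adj_of_visited he)

/-- A traversal of a face reaches all nodes of its boundary. -/
theorem seenAt_of_leftFace_eq (h : G.Undelivered s d resp c) {n a b : V} {F : Set ℂ}
    (hF : SeenAt c n F) (hab : G.graph.Adj a b) (heq : F = G.leftFace a b) : SeenAt c a F := by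
  obtain ⟨t, e, he, hFe⟩ := h.exists_visited_of_seenAt hF
  have hw := h.planar.sameWalk_of_leftFace_eq (fun x _ x' _ _ _ => h.connected.preconnected x x')
    (h.adj_of_visited he) (y := (a, b)) hab (hFe.trans heq)
  obtain ⟨t', ht'⟩ := h.exists_visited_of_sameWalk he hw
  rw [heq]
  exact h.seenAt_of_visited ht'

/-- The queue of `d` starts empty, and only forwarding adds packets; at `d` that would be a
delivery. -/
theorem not_seenAt_dest (h : G.Undelivered s d resp c) (F : Set ℂ) : ¬ SeenAt c d F := by
  rintro ⟨t, p, hp, -⟩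
  induction t generalizing p with
  | zero =>
    obtain ⟨F, κ, -, -, -, -, h2⟩ := h.initial
    simp [h2 d h.ne.symm] at hp
  | succ t ih =>
    by_cases hp' : p ∈ (c t).sq d
    · exact ih p hp'
    · obtain ⟨m, T, new, -, ⟨hd, -⟩, -⟩ := h.exists_forwards_of_new hp hp'
      exact hd rfl

/-- A traversal of a face passes on to the other faces at each of its entry points. -/
theorem seenAt_of_isEntryPoint (h : G.Undelivered s d resp c) {n : V} (hn : n ≠ s)
    {F F' : Set ℂ} (hF : SeenAt c n F) (hne : F' ≠ F) (hent : G.IsEntryPoint s d resp n F)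
    (hent' : G.IsEntryPoint s d resp n F') : SeenAt c n F' := by
  obtain ⟨t, p, hp, hpF⟩ := hF
  induction t generalizing p with
  | zero =>
    obtain ⟨F, κ, -, -, -, -, h2⟩ := h.initial
    simp [h2 n hn] at hp
  | succ t ih =>
    by_cases hp' : p ∈ (c t).sq n
    · exact ih p hp' hpF
    · obtain ⟨m, T, new, hT, ⟨-, x, S, κ, -, hS, -, rfl⟩, hmem, hsub⟩ :=
        h.exists_forwards_of_new hp hp'
      have hnew : F' ∈ S → SeenAt c n F' := fun hF' =>
        ⟨t + 1, _, hsub _ (mem_forwarded.2 (Or.inr ⟨F', hF', Or.inl rfl⟩)), rfl⟩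
      have hfor : SeenAt c n T.face := ⟨t + 1, _, hsub _ (mem_forwarded.2 (Or.inl rfl)), rfl⟩
      -- Whether the packet is the forwarded token or belongs to a started traversal, `T.face` and
      -- `S` together contain every face to which `n` is an entry point.
      rcases mem_forwarded.1 hmem with rfl | ⟨F'', hF'', hp⟩
      · subst hpF
        exact hnew ((hS F').2 ⟨hne, hent, hent'⟩)
      · by_cases hT' : F' = T.face
        · rw [hT']
          exact hfor
        · exact hnew ((hS F').2 ⟨hT', ((hS F'').1 hF'').2.1, hent'⟩)

end Undelivered

/-! ### Propagation of the seen faces along `(s,d)`. -/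

theorem pos_notMem_sdSeg {s d : V} (hsd : s ≠ d) : G.pos s ∉ G.sdSeg s d := by
  rw [sdSeg, left_mem_openSegment_iff]
  exact G.pos_injective.ne hsd

/-- If an edge at `s` has another point on `(s,d)` and does not contain `d`, then it ends on
`(s,d)`. -/
theorem pos_mem_sdSeg_of_mem_edgeSeg {s d b : V} {t : ℝ} (ht : 0 < t)
    (hp : G.dartPoint s b t ∈ G.sdSeg s d) (hd : G.pos d ∉ G.edgeSeg s b) :
    G.pos b ∈ G.sdSeg s d := by
  rw [sdSeg, openSegment_eq_image'] at hp ⊢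
  obtain ⟨u, ⟨h0, h1⟩, hu⟩ := hp
  have ht' : (t : ℂ) ≠ 0 := by exact_mod_cast ht.ne'
  have hu' : (u : ℂ) ≠ 0 := by exact_mod_cast h0.ne'
  simp only [dartPoint, Complex.real_smul, add_right_inj] at hu
  -- The common point has parameter `t` on the edge and `u` on the segment, so `b` has parameter `u
  -- / t`; were this at least `1`, `d` would lie on the edge at parameter `t / u`.
  refine ⟨u / t, ⟨by positivity, ?_⟩, ?_⟩
  · rw [div_lt_one ht]
    by_contra! hle
    refine hd (mem_edgeSeg_iff.2 ⟨t / u, by positivity, (div_le_one h0).2 hle, ?_⟩)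
    push_cast
    field_simp
    linear_combination hu
  · simp only [Complex.real_smul]
    push_cast
    field_simp
    linear_combination hu

theorem exists_isNext_R_to [Finite V] {n c : V} (hc : G.graph.Adj n c) :
    ∃ b, G.graph.Adj n b ∧ G.IsNext Hand.R n b c := by
  obtain ⟨b, hb, hmin⟩ := Set.exists_min_image {b | G.graph.Adj n b}
    (fun b => cwAngle (G.pos b - G.pos n) (G.pos c - G.pos n)) (Set.toFinite _) ⟨c, hc⟩
  exact ⟨b, hb, IsNext.toRight (h := ⟨hb, hmin⟩) hc⟩

theorem Planar.isEntryPoint_of_crossingEdge [Finite V] (hG : G.Planar) {s d n m : V}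
    {resp : V → V → Prop} (hc : G.CrossingEdge s d n m) (hr : resp n m)
    (hne : G.leftFace n m ≠ G.leftFace m n) :
    G.IsEntryPoint s d resp n (G.leftFace n m) ∧ G.IsEntryPoint s d resp n (G.leftFace m n) := by
  obtain ⟨hnm, p, hp, hpsd⟩ := id hc
  have e1 : G.edgeSeg n m ⊆ closure (G.leftFace n m) := hG.edgeSeg_subset_closure hnm
  have e2 : G.edgeSeg n m ⊆ closure (G.leftFace m n) := by
    rw [edgeSeg_comm]; exact hG.edgeSeg_subset_closure hnm.symm
  have hn : G.pos n ∈ G.edgeSeg n m := left_mem_segment _ _ _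
  exact ⟨⟨hG.isFace_leftFace hnm, e1 hn, ⟨p, e1 hp, hpsd⟩, _, hne.symm,
      hG.isFace_leftFace hnm.symm, e2 hn, ⟨p, e2 hp, hpsd⟩, m, hc, hr, e1, e2⟩,
    ⟨hG.isFace_leftFace hnm.symm, e2 hn, ⟨p, e2 hp, hpsd⟩, _, hne,
      hG.isFace_leftFace hnm, e1 hn, ⟨p, e1 hp, hpsd⟩, m, hc, hr, e2, e1⟩⟩

/-- The face `F` is traversed at some time. -/
def Seen (c : ℕ → Config V) (F : Set ℂ) : Prop := ∃ n, SeenAt c n F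

namespace Undelivered

variable {s d : V} {resp : V → V → Prop} {c : ℕ → Config V}

theorem exists_adj (h : G.Undelivered s d resp c) (n : V) : ∃ b, G.graph.Adj n b := by
  have : Nontrivial V := ⟨s, d, h.ne⟩
  exact h.connected.preconnected.exists_adj_of_nontrivial n

variable [Finite V]

theorem isFace_of_seen (h : G.Undelivered s d resp c) {F : Set ℂ} (hF : Seen c F) :
    G.IsFace F := by
  obtain ⟨n, hn⟩ := hF
  exact h.isFace_of_seenAt hn

theorem seenAt_of_seen (h : G.Undelivered s d resp c) {a b : V} (hab : G.graph.Adj a b)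
    (hF : Seen c (G.leftFace a b)) :
    SeenAt c a (G.leftFace a b) ∧ SeenAt c b (G.leftFace a b) := by
  obtain ⟨n, hn⟩ := hF
  obtain ⟨x, hx⟩ := exists_isNext (G := G) hab.symm
  exact ⟨h.seenAt_of_leftFace_eq hn hab rfl,
    h.seenAt_of_leftFace_eq hn hx.1 (h.planar.leftFace_eq_of_isNext hab.symm hx)⟩

/-- Otherwise `F` would be on the left of a dart leaving `d`, and its traversal would bring a packet
to `d`. -/
theorem dest_notMem_closure (h : G.Undelivered s d resp c) {F : Set ℂ} (hF : Seen c F) :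
    G.pos d ∉ closure F := by
  intro hd
  obtain ⟨b, hb⟩ := h.exists_adj d
  obtain ⟨x, hx, rfl⟩ := h.planar.exists_eq_leftFace_of_nodeBorders hb (h.isFace_of_seen hF) hd
  exact h.not_seenAt_dest _ (h.seenAt_of_seen hx hF).1

/-- The traversal reaches both ends of the edge, and a designated one passes it on. Excluding `s` at
both ends is needed since either may be the designated one. -/
theorem seen_across (h : G.Undelivered s d resp c)
    (hresp : ∀ a b : V, G.CrossingEdge s d a b → resp a b ∨ resp b a) {a b : V}
    (hc : G.CrossingEdge s d a b) (ha : a ≠ s) (hb : b ≠ s) (hF : Seen c (G.leftFace a b)) :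
    Seen c (G.leftFace b a) := by
  by_cases hne : G.leftFace a b = G.leftFace b a
  · rwa [← hne]
  obtain ⟨h1, h2⟩ := h.seenAt_of_seen hc.1 hF
  rcases hresp a b hc with hr | hr
  · obtain ⟨e1, e2⟩ := h.planar.isEntryPoint_of_crossingEdge hc hr hne
    exact ⟨a, h.seenAt_of_isEntryPoint ha h1 (Ne.symm hne) e1 e2⟩
  · have hc' : G.CrossingEdge s d b a := ⟨hc.1.symm, by rw [edgeSeg_comm]; exact hc.2⟩
    obtain ⟨e1, e2⟩ := h.planar.isEntryPoint_of_crossingEdge hc' hr (Ne.symm hne)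
    exact ⟨b, h.seenAt_of_isEntryPoint hb h2 (Ne.symm hne) e2 e1⟩

/-- At a node on `(s,d)` the traversals pass all edges, except possibly the one to `s`; so they
reach all faces there. -/
theorem seen_leftFace_of_node (h : G.Undelivered s d resp c)
    (hresp : ∀ a b : V, G.CrossingEdge s d a b → resp a b ∨ resp b a) {m : V}
    (hm : G.pos m ∈ G.sdSeg s d) {F : Set ℂ} (hF : Seen c F) (hmF : G.pos m ∈ closure F) {x : V}
    (hx : G.graph.Adj m x) : Seen c (G.leftFace m x) := by
  have hms : m ≠ s := by
    rintro rfl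
    exact pos_notMem_sdSeg h.ne hm
  set A : Set V := {x | G.graph.Adj m x ∧ Seen c (G.leftFace m x)} with hA
  set B : Set V := {x | G.graph.Adj m x ∧ Seen c (G.leftFace x m)} with hB
  have hcross : ∀ x, G.graph.Adj m x → G.CrossingEdge s d m x :=
    fun x hx => ⟨hx, G.pos m, left_mem_segment _ _ _, hm⟩
  have hAB : ∀ x, x ≠ s → (x ∈ A ↔ x ∈ B) := by
    refine fun x hxs => ⟨fun ⟨h1, h2⟩ => ⟨h1, h.seen_across hresp (hcross x h1) hms hxs h2⟩,
      fun ⟨h1, h2⟩ => ⟨h1, ?_⟩⟩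
    refine h.seen_across hresp ⟨h1.symm, ?_⟩ hxs hms h2
    rw [edgeSeg_comm]
    exact (hcross x h1).2
  -- Passing a corner keeps the face, so rotating back by one edge injects `A` into `B`.
  have hcard : A.ncard ≤ B.ncard := by
    have hprev : ∀ y ∈ A, ∃ x, G.graph.Adj m x ∧ G.IsNext Hand.R m x y :=
      fun y hy => exists_isNext_R_to hy.1
    choose! f hf hf' using hprev
    refine Set.ncard_le_ncard_of_injOn f (fun y hy => ⟨hf y hy, ?_⟩) ?_ (Set.toFinite _)
    · rw [h.planar.leftFace_eq_of_isNext (hf y hy) (hf' y hy)]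
      exact hy.2
    · intro y hy y' hy' heq
      have := hf' y' hy'
      rw [← heq] at this
      exact (hf' y hy).unique h.planar this
  have hsub : A ⊆ B := by
    intro y hy
    by_cases hys : y = s
    · subst hys
      by_contra hyB
      -- `A` and `B` can differ only at `s`, and the count rules out that `s` is in `A` alone. So
      -- the edge to `s` can be passed clockwise without any handover across it.
      have hlt : B ⊂ A := by
        refine Set.ssubset_iff_subset_ne.2 ⟨fun z hz => ?_, fun heq => hyB (heq ▸ hy)⟩
        exact (hAB z (fun hzs => hyB (hzs ▸ hz))).2 hz
      exact absurd hcard (not_le.2 (Set.ncard_lt_ncard hlt (Set.toFinite _)))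
    · exact (hAB y hys).1 hy
  obtain ⟨y, hy, rfl⟩ :=
    h.planar.exists_eq_leftFace_of_nodeBorders hx (h.isFace_of_seen hF) hmF
  refine forall_adj_of_isNext_closed h.planar (fun x => Seen c (G.leftFace m x)) hy hF ?_ x hx
  intro z w hz hPz hw
  rw [← h.planar.leftFace_eq_of_isNext hz hw]
  exact (hsub ⟨hz, hPz⟩ : z ∈ B).2

/-- An edge at `s` cannot contain `d`, which is not in the closure of a seen face; so its other end
lies on `(s,d)`, and all faces there are seen. -/
theorem seen_across_of_mem_sdSeg (h : G.Undelivered s d resp c)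
    (hresp : ∀ a b : V, G.CrossingEdge s d a b → resp a b ∨ resp b a) {a b : V}
    (hab : G.graph.Adj a b) {t : ℝ} (h0 : 0 < t) (h1 : t < 1)
    (hp : G.dartPoint a b t ∈ G.sdSeg s d) (hF : Seen c (G.leftFace a b)) :
    Seen c (G.leftFace b a) := by
  have hcl := h.planar.edgeSeg_subset_closure hab
  have hd : G.pos d ∉ G.edgeSeg a b := fun hd => h.dest_notMem_closure hF (hcl hd)
  by_cases ha : a = s
  · subst ha
    exact h.seen_leftFace_of_node hresp (pos_mem_sdSeg_of_mem_edgeSeg h0 hp hd) hF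
      (hcl (right_mem_segment _ _ _)) hab.symm
  by_cases hb : b = s
  · subst hb
    rw [edgeSeg_comm] at hd
    rw [dartPoint_symm, ← Complex.ofReal_one, ← Complex.ofReal_sub] at hp
    have hm := pos_mem_sdSeg_of_mem_edgeSeg (by linarith) hp hd
    obtain ⟨x, hx⟩ := exists_isNext (G := G) hab
    rw [h.planar.leftFace_eq_of_isNext hab hx]
    exact h.seen_leftFace_of_node hresp hm hF (hcl (left_mem_segment _ _ _)) hx.1
  · exact h.seen_across hresp ⟨hab, _, (dartPoint_mem_edgeSeg_iff hab.ne).2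
      ⟨by simp, by simpa using h0.le, by simpa using h1.le⟩, hp⟩ ha hb hF

/-- Along `(s,d)` the closures of the traversed faces form an open set. -/
theorem seen_mem_nhds (h : G.Undelivered s d resp c)
    (hresp : ∀ a b : V, G.CrossingEdge s d a b → resp a b ∨ resp b a) {p : ℂ}
    (hp : p ∈ G.sdSeg s d) {F : Set ℂ} (hF : Seen c F) (hpF : p ∈ closure F) :
    {z | ∃ F, Seen c F ∧ z ∈ closure F} ∈ nhds p := by
  have hface := h.isFace_of_seen hF
  by_cases hpd : p ∈ G.drawing
  · obtain ⟨a, b, hab, hpab⟩ := hpd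
    have node : ∀ n x, G.graph.Adj n x → p = G.pos n →
        {z | ∃ F, Seen c F ∧ z ∈ closure F} ∈ nhds p := by
      rintro n x hx rfl
      obtain ⟨ρ, hρ, hball⟩ := h.planar.exists_ball_leftFace hx
      refine Filter.mem_of_superset (Metric.ball_mem_nhds _ hρ) fun z hz => ?_
      obtain ⟨y, hy, hz⟩ := hball z hz
      refine ⟨_, h.seen_leftFace_of_node hresp hp hF hpF hy, ?_⟩
      rcases hz with hz | hz
      · exact h.planar.edgeSeg_subset_closure hy hz
      · exact subset_closure hz
    obtain ⟨t, h0, h1, ht⟩ := mem_edgeSeg_iff.1 hpab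
    rcases h0.eq_or_lt with rfl | h0
    · exact node a b hab (by simpa using ht)
    rcases h1.eq_or_lt with rfl | h1
    · exact node b a hab.symm (by simpa using ht)
    change p = G.dartPoint a b t at ht
    subst ht
    have both : Seen c (G.leftFace a b) ∧ Seen c (G.leftFace b a) := by
      rcases h.planar.eq_leftFace_of_mem_closure hab h0 h1 hface hpF with rfl | rfl
      · exact ⟨hF, h.seen_across_of_mem_sdSeg hresp hab h0 h1 hp hF⟩
      · rw [dartPoint_symm, ← Complex.ofReal_one, ← Complex.ofReal_sub] at hp
        exact ⟨h.seen_across_of_mem_sdSeg hresp hab.symm (by linarith) (by linarith) hp hF, hF⟩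
    obtain ⟨ρ, hρ, hball⟩ := h.planar.exists_ball_edge hab h0 h1
    refine Filter.mem_of_superset (Metric.ball_mem_nhds _ hρ) fun z hz => ?_
    rcases hball z hz with hz | hz | hz
    · exact ⟨_, both.1, h.planar.edgeSeg_subset_closure hab hz⟩
    · exact ⟨_, both.1, subset_closure hz⟩
    · exact ⟨_, both.2, subset_closure hz⟩
  · have hface' := isFace_pathComponentIn hpd
    have hmem := mem_pathComponentIn_self (F := G.drawingᶜ) hpd
    obtain ⟨z, hz, hzF⟩ := mem_closure_iff.1 hpF _ hface'.isOpen hmem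
    rw [hface'.eq_of_mem hface hz hzF] at hmem
    exact Filter.mem_of_superset (hface.isOpen.mem_nhds hmem)
      fun z hz => ⟨F, hF, subset_closure hz⟩

theorem isClosed_seen (h : G.Undelivered s d resp c) :
    IsClosed {z | ∃ F, Seen c F ∧ z ∈ closure F} := by
  have heq : {z | ∃ F, Seen c F ∧ z ∈ closure F} = ⋃ F ∈ {F | Seen c F}, closure F := by
    ext z; simp
  rw [heq]
  refine Set.Finite.isClosed_biUnion ?_ fun _ _ => isClosed_closure
  refine (Set.finite_range fun e : V × V => G.leftFace e.1 e.2).subset ?_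
  rintro F ⟨n, hF⟩
  obtain ⟨t, e, -, he⟩ := h.exists_visited_of_seenAt hF
  exact ⟨e, he⟩

theorem false (h : G.Undelivered s d resp c)
    (hresp : ∀ a b : V, G.CrossingEdge s d a b → resp a b ∨ resp b a) : False := by
  set C : Set ℂ := {z | ∃ F, Seen c F ∧ z ∈ closure F} with hC
  obtain ⟨F, κ, -, ⟨p, hpF, hp⟩, -, hsq, -⟩ := h.initial
  have hF : Seen c F := ⟨s, 0, _, hsq ▸ mem_tokenPair.2 (Or.inl rfl), rfl⟩
  have hpre : IsPreconnected (G.sdSeg s d) := (convex_openSegment _ _).isPreconnected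
  have hint : ∀ z ∈ G.sdSeg s d, z ∈ C → z ∈ interior C := fun z hz ⟨F, hF, hzF⟩ =>
    mem_interior_iff_mem_nhds.2 (h.seen_mem_nhds hresp hz hF hzF)
  -- The segment is connected and covered by the disjoint open sets `interior C` and the complement
  -- of `C`; the initial face provides a point in the former.
  have hsub : G.sdSeg s d ⊆ interior C := by
    refine hpre.subset_left_of_subset_union isOpen_interior h.isClosed_seen.isOpen_compl
      (disjoint_compl_right.mono_left interior_subset) (fun z hz => ?_)
      ⟨p, hp, hint p hp ⟨F, hF, hpF⟩⟩
    by_cases hzC : z ∈ C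
    · exact Or.inl (hint z hz hzC)
    · exact Or.inr hzC
  have hd : G.pos d ∈ C := by
    have : G.pos d ∈ closure (G.sdSeg s d) := by
      rw [sdSeg, closure_openSegment]
      exact right_mem_segment _ _ _
    exact closure_minimal (hsub.trans interior_subset) h.isClosed_seen this
  obtain ⟨F, hF, hdF⟩ := hd
  exact h.dest_notMem_closure hF hdF

end Undelivered

end GeometricGraph

end TwoFace

end

theorem mainTheorem1 {V : Type*} [Finite V] (G : TwoFace.GeometricGraph V)
    (hconn : G.graph.Connected) (hplanar : G.Planar) (s d : V) (hsd : s ≠ d)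
    (resp : V → V → Prop)
    (hresp : ∀ a b : V, G.CrossingEdge s d a b → resp a b ∨ resp b a)
    (c : ℕ → TwoFace.Config V) (hc : G.IsComputation s d resp c) :
    ∃ t, (c t).delivered ≠ 0 := by
  by_contra! hdel
  have h : G.Undelivered s d resp c := ⟨hplanar, hconn, hsd, hc, hdel⟩
  exact h.false hresp
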